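/- For each sample size $n$ consider the grouped linear model $y = \sum_{g=1}^{G_n} X_g\beta^0_g + \epsilon$ with $\epsilon \sim N(0,\sigma^2 I_n)$ and $\sigma^2>0$ known and fixed, where $X_g$ is an $n\times m_g$ matrix of full column rank ($m_g \ge 1$), the design is block orthogonal ($X_g^{T} X_h = 0$ for $g \ne h$), and $G_n \le n$; the $X_g$, $m_g$ and $\beta_g^0$ may depend on $n$. Let $\mathcal A_n = \{g : \beta^0_g \ne 0\}$ be the set of active groups, $G_{A_n} = |\mathcal A_n|$, $Q_{n,g} = X_g^{T}X_g/n$, and let $\hat\beta_g = (X_g^{T}X_g)^{-1}X_g^{T}y$ be the least squares estimate. Prior. Given $\tau$ and $\sigma^2$, let $y \mid \beta \sim N(\sum_g X_g\beta_g, \sigma^2 I_n)$, let the $\beta_g \mid \lambda_g^2 \sim N_{m_g}(0, \lambda_g^2\sigma^2\tau^2 (X_g^{T}X_g)^{-1})$ be independent, and let the $\lambda_g^2$ be independent with a proper density on $(0,\infty)$ proportional to $t^{-a-1}L(t)$, where $L:(0,\infty)\to(0,\infty)$ is a measurable, non-constant function with $L(\alpha x)/L(x) \to 1$ as $x \to \infty$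 for every $\alpha>0$. Put $\kappa_g = 1/(1+\lambda_g^2\tau^2)$, and let $E(\,\cdot \mid \tau,\sigma^2,y)$ denote posterior expectation in this model. Let $c_1\ge 2$, $c_2\ge 1$, $W_g = n\hat\beta_g^{T}Q_{n,g}\hat\beta_g/\sigma^2$ and $$\hat\tau^{EB} = \max\Big\{\frac1{G_n},\ \frac1{c_2G_n}\,\#\{g : W_g > c_1\log G_n\}\Big\}.$$ The data-adaptive half-thresholding (HT) rule declares group $g$ active if $E(1-\kappa_g\mid \hat\tau^{EB},\sigma^2,y) > 1/2$, where $\hat\tau^{EB}$ is plugged in for $\tau$; the corresponding estimator $\hat\beta^{HT}_{g}$ is the posterior mean $E(\beta_g\mid\hat\tau^{EB},\sigma^2,y)$ if group $g$ is declared active, and $0$ otherwise. Assumptions. Assumption 1: $L$ is bounded above on $(0,\infty)$, and there are $c_0,t_0>0$ with $L(t)\ge c_0$ for all $t\ge t_0$. (A1): there is $C_1>0$ such that, for all $n$ and all $g\in\mathcal A_n$, the smallest eigenvalue of $Q_{n,g}$ exceeds $C_1$. (A2): there are $c>0$ and $0\le b<1/2$ such that $\min_j|\beta^0_{gj}| >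 c\,n^{-b}$ for all $n$ and all $g\in\mathcal A_n$. (A3): $\sup_n\max_{g\le G_n} m_g<\infty$. Moreover $G_{A_n}\to\infty$, and $G_n^{\varepsilon_1}\lesssim G_{A_n}\lesssim G_n^{\varepsilon_2}$ (inequalities up to constant factors, for all large $n$) for some $0<\varepsilon_1<\varepsilon_2$, where either $a\ge1$ and $\varepsilon_2<1/2$, or $1/2<a<1$ and $\varepsilon_2<1-\frac1{2a}$. Theorem. Under these assumptions the data-adaptive HT rule is selection consistent: with $\widehat{\mathcal A}_n=\{g:\hat\beta^{HT}_{g}\neq 0\}$, $$\lim_{n\to\infty}P(\mathcal A_n=\widehat{\mathcal A}_n)=1,$$ and the same holds with $\widehat{\mathcal A}_n$ replaced by the set of groups that the rule declares active. -/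

import Mathlib

open MeasureTheory ProbabilityTheory Filter Topology Asymptotics Matrix

/-- The density at `x` of the `k`-dimensional normal distribution with mean `μ` and (positive
definite) covariance matrix `S`. -/
noncomputable def mvNormalDensity {k : ℕ} (μ : Fin k → ℝ) (S : Matrix (Fin k) (Fin k) ℝ)
    (x : Fin k → ℝ) : ℝ :=
  (Real.sqrt ((2 * Real.pi) ^ k * S.det))⁻¹ * Real.exp (-((x - μ) ⬝ᵥ (S⁻¹ *ᵥ (x - μ))) / 2)

/-- Karamata slow variation at infinity. -/
def IsSlowlyVarying (L : ℝ → ℝ) : Prop :=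
  ∀ α : ℝ, 0 < α → Tendsto (fun x => L (α * x) / L x) atTop (𝓝 1)

/-- The prior density of a squared local shrinkage parameter `λ²`, at the point `t`: the normalized
version of `t ^ (-a - 1) * L t` on `(0, ∞)`. -/
noncomputable def localPriorDensity (a : ℝ) (L : ℝ → ℝ) (t : ℝ) : ℝ :=
  if 0 < t then (∫ s in Set.Ioi (0 : ℝ), s ^ (-a - 1) * L s)⁻¹ * (t ^ (-a - 1) * L t) else 0

/-- The shrinkage coefficient `κ = 1 / (1 + λ² τ²)`, as a function of `τ` and `t = λ²`. -/
noncomputable def shrinkage (τ t : ℝ) : ℝ := 1 / (1 + t * τ ^ 2)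

/-- Grouped regressors for `n` observations: the number `G` of groups, the group sizes `m_g`, and
the `n × m_g` design matrices `X_g`. -/
structure GroupDesign (n : ℕ) where
  G : ℕ
  size : Fin G → ℕ
  X : (g : Fin G) → Matrix (Fin n) (Fin (size g)) ℝ

namespace GroupDesign

/-- Grouped coefficient vectors `β = (β_1, …, β_G)`, with `β_g ∈ ℝ^{m_g}`. -/
abbrev Coef {n : ℕ} (D : GroupDesign n) : Type := (g : Fin D.G) → Fin (D.size g) → ℝ

/-- The regression function `X β = ∑_g X_g β_g`. -/
def mean {n : ℕ} (D : GroupDesign n) (b : D.Coef) : Fin n → ℝ := ∑ g, D.X g *ᵥ b g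

/-- `X_gᵀ X_h = 0` for distinct groups `g`, `h`. -/
def BlockOrthogonal {n : ℕ} (D : GroupDesign n) : Prop :=
  ∀ g h : Fin D.G, g ≠ h → (D.X g)ᵀ * D.X h = 0

/-- `Q_{n,g} = X_gᵀ X_g / n`. -/
noncomputable def Q {n : ℕ} (D : GroupDesign n) (g : Fin D.G) :
    Matrix (Fin (D.size g)) (Fin (D.size g)) ℝ :=
  (n : ℝ)⁻¹ • ((D.X g)ᵀ * D.X g)

/-- The law of the data `y = X β + ε`, with `ε ∼ N(0, σ² I_n)`. -/
noncomputable def dataLaw {n : ℕ} (D : GroupDesign n) (σ : ℝ) (b : D.Coef) :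
    Measure (Fin n → ℝ) :=
  Measure.pi fun i => gaussianReal (D.mean b i) (Real.toNNReal (σ ^ 2))

/-- The set of active groups. -/
def active {n : ℕ} (D : GroupDesign n) (b : D.Coef) : Set (Fin D.G) := {g | b g ≠ 0}

/-- The least squares estimate of `β_g` (for a block orthogonal design of full column rank, the
`g`-th block of the joint least squares estimate of `β`). -/
noncomputable def lse {n : ℕ} (D : GroupDesign n) (y : Fin n → ℝ) (g : Fin D.G) :
    Fin (D.size g) → ℝ :=
  ((D.X g)ᵀ * D.X g)⁻¹ *ᵥ ((D.X g)ᵀ *ᵥ y)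

/-- `W_g = n β̂_gᵀ Q_{n,g} β̂_g / σ²`. -/
noncomputable def W {n : ℕ} (D : GroupDesign n) (σ : ℝ) (y : Fin n → ℝ) (g : Fin D.G) : ℝ :=
  (n : ℝ) * (D.lse y g ⬝ᵥ (D.Q g *ᵥ D.lse y g)) / σ ^ 2

/-- The empirical Bayes estimate of the global shrinkage parameter. -/
noncomputable def tauEB {n : ℕ} (D : GroupDesign n) (σ c₁ c₂ : ℝ) (y : Fin n → ℝ) : ℝ :=
  max (1 / (D.G : ℝ))
    (1 / (c₂ * (D.G : ℝ)) * ({g | c₁ * Real.log (D.G : ℝ) < D.W σ y g}.ncard : ℝ))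

/-- The joint density of `(λ², β, y)` at `(v, b, y)`, given `τ` and `σ`, in the hierarchical model
in which the `λ_g²` are independent with density `localPriorDensity a L`, the `β_g` are, given
`λ²`, independent `N(0, λ_g² σ² τ² (X_gᵀ X_g)⁻¹)`, and `y` is, given `β`, `N(X β, σ² I_n)`. -/
noncomputable def jointDensity {n : ℕ} (D : GroupDesign n) (a : ℝ) (L : ℝ → ℝ) (σ τ : ℝ)
    (v : Fin D.G → ℝ) (b : D.Coef) (y : Fin n → ℝ) : ℝ :=
  (∏ g, localPriorDensity a L (v g)) *
    (∏ g, mvNormalDensity 0 ((v g * σ ^ 2 * τ ^ 2) • ((D.X g)ᵀ * D.X g)⁻¹) (b g)) *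
    mvNormalDensity (D.mean b) (σ ^ 2 • (1 : Matrix (Fin n) (Fin n) ℝ)) y

/-- The posterior expectation of `f (λ², β)` given the data `y`, for fixed `τ` and `σ`. -/
noncomputable def postExp {n : ℕ} (D : GroupDesign n) (a : ℝ) (L : ℝ → ℝ) (σ τ : ℝ)
    (y : Fin n → ℝ) (f : (Fin D.G → ℝ) → D.Coef → ℝ) : ℝ :=
  (∫ v : Fin D.G → ℝ, ∫ b : D.Coef, f v b * D.jointDensity a L σ τ v b y) /
    (∫ v : Fin D.G → ℝ, ∫ b : D.Coef, D.jointDensity a L σ τ v b y)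

/-- The posterior shrinkage weight `E(1 - κ_g | τ, σ², y)`. -/
noncomputable def postWeight {n : ℕ} (D : GroupDesign n) (a : ℝ) (L : ℝ → ℝ) (σ τ : ℝ)
    (y : Fin n → ℝ) (g : Fin D.G) : ℝ :=
  D.postExp a L σ τ y fun v _ => 1 - shrinkage τ (v g)

/-- The posterior mean of `β_g` given the data, for fixed `τ` and `σ`. -/
noncomputable def postMean {n : ℕ} (D : GroupDesign n) (a : ℝ) (L : ℝ → ℝ) (σ τ : ℝ)
    (y : Fin n → ℝ) (g : Fin D.G) : Fin (D.size g) → ℝ :=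
  fun j => D.postExp a L σ τ y fun _ b => b g j

/-- The groups declared active by the empirical Bayes half-thresholding rule. -/
def htRuleEB {n : ℕ} (D : GroupDesign n) (a : ℝ) (L : ℝ → ℝ) (σ c₁ c₂ : ℝ)
    (y : Fin n → ℝ) : Set (Fin D.G) :=
  {g | 1 / 2 < D.postWeight a L σ (D.tauEB σ c₁ c₂ y) y g}

/-- The empirical Bayes half-thresholding estimator of `β_g`: the posterior mean evaluated at the
empirical Bayes estimate of `τ` if the rule declares the group active, and zero otherwise. -/
noncomputable def htEstimatorEB {n : ℕ} (D : GroupDesign n) (a : ℝ) (L : ℝ → ℝ) (σ c₁ c₂ : ℝ)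
    (y : Fin n → ℝ) (g : Fin D.G) : Fin (D.size g) → ℝ :=
  if 1 / 2 < D.postWeight a L σ (D.tauEB σ c₁ c₂ y) y g then
    D.postMean a L σ (D.tauEB σ c₁ c₂ y) y g
  else 0

/-- The groups whose empirical Bayes half-thresholding estimate is nonzero. -/
def htSelectedEB {n : ℕ} (D : GroupDesign n) (a : ℝ) (L : ℝ → ℝ) (σ c₁ c₂ : ℝ)
    (y : Fin n → ℝ) : Set (Fin D.G) :=
  {g | D.htEstimatorEB a L σ c₁ c₂ y g ≠ 0}

end GroupDesign

/-! Block orthogonality splits the likelihood into one factor per group, and the prior covariance of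
a group is proportional to the inverse of its Gram matrix. Given `λ²`, all Gaussian integrals are
therefore explicit, and the posterior weight of a group is a ratio of integrals over `t = λ²`
depending on the data only through `W` and `τ` (`postWeight_eq`). The posterior mean is that weight
times the least squares estimate (`postMean_eq`). Two deterministic bounds, uniform over bounded
group sizes, control the ratio. It is at most `C τ^(2α) exp (W/2)` for `α ≤ 1`, `α < a`
(`exists_weight_upper_bound`), and at least `3/4 - C τ^(-2a) exp (-3W/32)`
(`exists_weight_lower_bound`). All randomness is confined to one event: the noise statistics satisfy
`∑ exp (W/(2c)) ≤ G^(1+η)`, where `c = 1/(1-η)`. The `χ²` moment generating function and Markov's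
inequality give it probability at least `1 - O(G^(-η))`, without using independence between groups.
On this event every noise statistic is at most `2c(1+η) log G`, and at most `G^(2η)` of them exceed
`c₁ log G`. Hence `τ ≤ const * G^(ε₂-1)` (`tauEB_le`). An inactive group then has weight at most a
constant times `G^(c(1+η) - 2α(1-ε₂))`, which tends to zero for suitable `α`, `η`
(`exists_exponents`). For an active group the signal, of order at least `n^(1-2b)`, makes `W` exceed
any multiple of `log n`, while `τ ≥ 1/G ≥ 1/n` costs only a power of `n`; so the weight eventually
exceeds `1/2`. -/

/-! ### Quadratic forms of positive matrices -/

section QuadraticForm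

variable {m : ℕ} {A : Matrix (Fin m) (Fin m) ℝ}

/-- The quadratic form of a matrix. -/
def quad (A : Matrix (Fin m) (Fin m) ℝ) (u : Fin m → ℝ) : ℝ := u ⬝ᵥ (A *ᵥ u)

lemma quad_smul (A : Matrix (Fin m) (Fin m) ℝ) (r : ℝ) (u : Fin m → ℝ) :
    quad A (r • u) = r ^ 2 * quad A u := by
  simp only [quad, mulVec_smul, dotProduct_smul, smul_dotProduct, smul_eq_mul]; ring

lemma quad_neg (A : Matrix (Fin m) (Fin m) ℝ) (u : Fin m → ℝ) : quad A (-u) = quad A u := by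
  simp [quad, mulVec_neg]

lemma dotProduct_mulVec_comm_of_isHermitian (hA : A.IsHermitian) (u v : Fin m → ℝ) :
    u ⬝ᵥ (A *ᵥ v) = v ⬝ᵥ (A *ᵥ u) := by
  have h : Aᵀ = A := by rw [← conjTranspose_eq_transpose_of_trivial]; exact hA
  rw [dotProduct_mulVec, ← mulVec_transpose, h, dotProduct_comm]

lemma quad_add (hA : A.IsHermitian) (u v : Fin m → ℝ) :
    quad A (u + v) = quad A u + 2 * (u ⬝ᵥ (A *ᵥ v)) + quad A v := by
  simp only [quad, mulVec_add, dotProduct_add, add_dotProduct]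
  rw [dotProduct_mulVec_comm_of_isHermitian hA v u]; ring

lemma quad_nonneg (hA : A.PosSemidef) (u : Fin m → ℝ) : 0 ≤ quad A u := by
  simpa [quad] using hA.dotProduct_mulVec_nonneg u

lemma continuous_quad (A : Matrix (Fin m) (Fin m) ℝ) : Continuous (quad A) := by
  unfold quad
  fun_prop

/-- A hermitian matrix with spectrum bounded below by `r` dominates `r` times the identity. -/
lemma mul_dotProduct_self_le_quad (hA : A.IsHermitian) {r : ℝ} (hr : ∀ e ∈ spectrum ℝ A, r ≤ e)
    (u : Fin m → ℝ) : r * (u ⬝ᵥ u) ≤ quad A u := by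
  have hB : (A - r • (1 : Matrix (Fin m) (Fin m) ℝ)).IsHermitian := by
    refine hA.sub ?_
    simp [IsHermitian]
  have hpsd : (A - r • (1 : Matrix (Fin m) (Fin m) ℝ)).PosSemidef := by
    refine hB.posSemidef_iff_eigenvalues_nonneg.2 fun i => ?_
    have h := hB.eigenvalues_mem_spectrum_real i
    have h2 : hB.eigenvalues i + r ∈ spectrum ℝ A := by
      rw [spectrum.mem_iff] at h ⊢
      convert h using 2
      simp only [map_add, Algebra.algebraMap_eq_smul_one]
      abel
    have := hr _ h2
    simpa using this
  have := quad_nonneg hpsd u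
  simp only [quad, sub_mulVec, smul_mulVec, one_mulVec, dotProduct_sub, dotProduct_smul,
    smul_eq_mul] at this ⊢
  linarith

lemma exists_pos_mul_dotProduct_self_le_quad (hA : A.PosDef) :
    ∃ r : ℝ, 0 < r ∧ ∀ u, r * (u ⬝ᵥ u) ≤ quad A u := by
  have hpos : ∀ e ∈ spectrum ℝ A, 0 < e := by
    intro e he
    rw [hA.isHermitian.spectrum_real_eq_range_eigenvalues] at he
    obtain ⟨i, rfl⟩ := he
    exact hA.eigenvalues_pos i
  have hfin : (spectrum ℝ A).Finite := by
    rw [hA.isHermitian.spectrum_real_eq_range_eigenvalues]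
    exact Set.finite_range _
  rcases (spectrum ℝ A).eq_empty_or_nonempty with h | h
  -- With empty spectrum (dimension zero) any positive constant serves; otherwise the smallest
  -- eigenvalue is taken.
  · exact ⟨1, one_pos, mul_dotProduct_self_le_quad hA.isHermitian (by simp [h])⟩
  · obtain ⟨r, hr, hmin⟩ := Set.exists_min_image _ id hfin h
    exact ⟨r, hpos r hr, mul_dotProduct_self_le_quad hA.isHermitian hmin⟩

end QuadraticForm

/-! ### Gaussian integrals with a linear term -/

section GaussianIntegral

variable {m : ℕ} {A : Matrix (Fin m) (Fin m) ℝ}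

/-- The total mass of `exp (-q / 2)` for the quadratic form `q` of a matrix. -/
noncomputable def gaussMass (A : Matrix (Fin m) (Fin m) ℝ) : ℝ :=
  ∫ b : Fin m → ℝ, Real.exp (-(quad A b) / 2)

lemma integrable_exp_neg_dotProduct_self {r : ℝ} (hr : 0 < r) :
    Integrable fun b : Fin m → ℝ => Real.exp (-r * (b ⬝ᵥ b)) := by
  have : (fun b : Fin m → ℝ => Real.exp (-r * (b ⬝ᵥ b))) =
      fun b => ∏ i, Real.exp (-r * b i ^ 2) := by
    ext b
    rw [← Real.exp_sum]
    simp [dotProduct, Finset.mul_sum, pow_two]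
  rw [this]
  exact Integrable.fintype_prod fun i => integrable_exp_neg_mul_sq hr

lemma integrable_exp_neg_quad (hA : A.PosDef) {c : ℝ} (hc : 0 < c) :
    Integrable fun b : Fin m → ℝ => Real.exp (-(c * quad A b) / 2) := by
  obtain ⟨r, hr, h⟩ := exists_pos_mul_dotProduct_self_le_quad hA
  refine (integrable_exp_neg_dotProduct_self (m := m) (r := c * r / 2) (by positivity)).mono'
    ?_ ?_
  · have := continuous_quad A
    exact (by fun_prop : Continuous fun b : Fin m → ℝ =>
      Real.exp (-(c * quad A b) / 2)).aestronglyMeasurable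
  · refine ae_of_all _ fun b => ?_
    rw [Real.norm_eq_abs, Real.abs_exp, Real.exp_le_exp]
    have := mul_le_mul_of_nonneg_left (h b) hc.le
    linarith

lemma integrable_coord_mul_exp_neg_quad (hA : A.PosDef) {c : ℝ} (hc : 0 < c) (j : Fin m) :
    Integrable fun b : Fin m → ℝ => b j * Real.exp (-(c * quad A b) / 2) := by
  obtain ⟨r, hr, h⟩ := exists_pos_mul_dotProduct_self_le_quad hA
  have hk : 0 < c * r / 4 := by positivity
  refine ((integrable_exp_neg_dotProduct_self (m := m) hk).const_mul (1 + 1 / (c * r / 4))).mono'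
    ?_ ?_
  · have := continuous_quad A
    exact (by fun_prop : Continuous fun b : Fin m → ℝ =>
      b j * Real.exp (-(c * quad A b) / 2)).aestronglyMeasurable
  · refine ae_of_all _ fun b => ?_
    rw [norm_mul, Real.norm_eq_abs, Real.norm_eq_abs, Real.abs_exp]
    -- The decay `exp (-(c * r / 2) * |b|²)` is split into two equal factors: one absorbs the
    -- polynomial `1 + |b|²`, the other stays integrable.
    set k := c * r / 4 with hkdef
    have h1 := mul_le_mul_of_nonneg_left (h b) hc.le
    have h2 : Real.exp (-(c * quad A b) / 2) ≤
        Real.exp (-k * (b ⬝ᵥ b)) * Real.exp (-k * (b ⬝ᵥ b)) := by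
      rw [← Real.exp_add, Real.exp_le_exp, hkdef]; linarith
    have h3 : b j ^ 2 ≤ b ⬝ᵥ b := by
      have := Finset.single_le_sum (f := fun i => b i * b i) (s := Finset.univ)
        (fun i _ => mul_self_nonneg _) (Finset.mem_univ j)
      simpa [dotProduct, pow_two] using this
    have h4 : |b j| ≤ 1 + b ⬝ᵥ b := by
      have := sq_abs (b j)
      nlinarith [sq_nonneg (|b j| - 1), abs_nonneg (b j)]
    have h5 : (b ⬝ᵥ b) * Real.exp (-k * (b ⬝ᵥ b)) ≤ 1 / k := by
      have := Real.add_one_le_exp (k * (b ⬝ᵥ b))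
      rw [neg_mul, Real.exp_neg, ← div_eq_mul_inv, div_le_div_iff₀ (Real.exp_pos _) hk]
      linarith
    have h6 : Real.exp (-k * (b ⬝ᵥ b)) ≤ 1 := by
      rw [Real.exp_le_one_iff]; nlinarith [sq_nonneg (b j)]
    calc |b j| * Real.exp (-(c * quad A b) / 2)
        ≤ (1 + b ⬝ᵥ b) * (Real.exp (-k * (b ⬝ᵥ b)) * Real.exp (-k * (b ⬝ᵥ b))) :=
          mul_le_mul h4 h2 (Real.exp_pos _).le (by linarith [sq_nonneg (b j)])
      _ = (Real.exp (-k * (b ⬝ᵥ b)) + (b ⬝ᵥ b) * Real.exp (-k * (b ⬝ᵥ b))) *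
          Real.exp (-k * (b ⬝ᵥ b)) := by ring
      _ ≤ (1 + 1 / k) * Real.exp (-k * (b ⬝ᵥ b)) := by gcongr

lemma gaussMass_pos (hA : A.PosDef) : 0 < gaussMass A := by
  have h := integrable_exp_neg_quad hA one_pos
  simp only [one_mul] at h
  exact integral_exp_pos h

/-- Rescaling by `√c`. Only this dependence on `c` matters: the mass itself always cancels later and
is never evaluated. -/
lemma integral_exp_neg_quad (A : Matrix (Fin m) (Fin m) ℝ) {c : ℝ} (hc : 0 < c) :
    ∫ b : Fin m → ℝ, Real.exp (-(c * quad A b) / 2) = (√c ^ m)⁻¹ * gaussMass A := by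
  have h := Measure.integral_comp_smul_of_nonneg (volume : Measure (Fin m → ℝ))
    (fun b => Real.exp (-(quad A b) / 2)) (√c) (hR := Real.sqrt_nonneg c)
  simp only [quad_smul, Real.sq_sqrt hc.le, Module.finrank_fin_fun, smul_eq_mul] at h
  exact h

/-- Completing the square, with centre `(s / c) • u`. -/
lemma linear_sub_quad_eq (hA : A.IsHermitian) (s : ℝ) {c : ℝ} (hc : 0 < c) (u b : Fin m → ℝ) :
    s * (u ⬝ᵥ (A *ᵥ b)) - c * quad A b / 2 =
      s ^ 2 * quad A u / (2 * c) + -(c * quad A (b - (s / c) • u)) / 2 := by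
  have h := quad_add hA (-((s / c) • u)) b
  rw [quad_neg, quad_smul, neg_dotProduct, smul_dotProduct, smul_eq_mul] at h
  rw [sub_eq_neg_add b, h]
  field_simp
  ring

lemma integrable_exp_linear_sub_quad (hA : A.PosDef) (s : ℝ) {c : ℝ} (hc : 0 < c)
    (u : Fin m → ℝ) :
    Integrable fun b : Fin m → ℝ => Real.exp (s * (u ⬝ᵥ (A *ᵥ b)) - c * quad A b / 2) := by
  simp only [linear_sub_quad_eq hA.isHermitian s hc, Real.exp_add]
  exact ((integrable_exp_neg_quad hA hc).comp_sub_right ((s / c) • u)).const_mul _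

lemma integral_exp_linear_sub_quad (hA : A.PosDef) (s : ℝ) {c : ℝ} (hc : 0 < c)
    (u : Fin m → ℝ) :
    ∫ b : Fin m → ℝ, Real.exp (s * (u ⬝ᵥ (A *ᵥ b)) - c * quad A b / 2) =
      Real.exp (s ^ 2 * quad A u / (2 * c)) * ((√c ^ m)⁻¹ * gaussMass A) := by
  simp only [linear_sub_quad_eq hA.isHermitian s hc, Real.exp_add]
  rw [integral_const_mul,
    integral_sub_right_eq_self (fun b : Fin m → ℝ => Real.exp (-(c * quad A b) / 2)),
    integral_exp_neg_quad A hc]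

/-- After recentring, the odd part integrates to zero and only the centre survives. -/
lemma integral_coord_mul_exp_linear_sub_quad (hA : A.PosDef) (s : ℝ) {c : ℝ} (hc : 0 < c)
    (u : Fin m → ℝ) (j : Fin m) :
    ∫ b : Fin m → ℝ, b j * Real.exp (s * (u ⬝ᵥ (A *ᵥ b)) - c * quad A b / 2) =
      s / c * u j * (Real.exp (s ^ 2 * quad A u / (2 * c)) * ((√c ^ m)⁻¹ * gaussMass A)) := by
  have hodd : ∫ b : Fin m → ℝ, b j * Real.exp (-(c * quad A b) / 2) = 0 := by
    have h := integral_neg_eq_self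
      (fun b : Fin m → ℝ => b j * Real.exp (-(c * quad A b) / 2)) volume
    simp only [quad_neg, Pi.neg_apply, neg_mul, integral_neg] at h
    linarith
  have hshift : ∀ b : Fin m → ℝ,
      b j * Real.exp (s * (u ⬝ᵥ (A *ᵥ b)) - c * quad A b / 2) =
      Real.exp (s ^ 2 * quad A u / (2 * c)) *
        (fun b' : Fin m → ℝ => b' j * Real.exp (-(c * quad A b') / 2) +
          s / c * u j * Real.exp (-(c * quad A b') / 2)) (b - (s / c) • u) := by
    intro b
    rw [linear_sub_quad_eq hA.isHermitian s hc, Real.exp_add]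
    simp only [Pi.sub_apply, Pi.smul_apply, smul_eq_mul]
    ring
  simp only [hshift]
  rw [integral_const_mul, integral_sub_right_eq_self (fun b' : Fin m → ℝ =>
      b' j * Real.exp (-(c * quad A b') / 2) + s / c * u j * Real.exp (-(c * quad A b') / 2)),
    integral_add (integrable_coord_mul_exp_neg_quad hA hc j)
      ((integrable_exp_neg_quad hA hc).const_mul _), hodd, integral_const_mul,
    integral_exp_neg_quad A hc]
  ring

end GaussianIntegral

/-! ### The prior density of `λ²` -/

section PriorDensity

variable {a : ℝ} {L : ℝ → ℝ}

lemma localPriorDensity_eq_indicator (a : ℝ) (L : ℝ → ℝ) :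
    localPriorDensity a L = (Set.Ioi (0 : ℝ)).indicator fun t =>
      (∫ s in Set.Ioi (0 : ℝ), s ^ (-a - 1) * L s)⁻¹ * (t ^ (-a - 1) * L t) := by
  ext t
  simp [localPriorDensity, Set.indicator_apply]

lemma integrable_localPriorDensity
    (hprior : IntegrableOn (fun t : ℝ => t ^ (-a - 1) * L t) (Set.Ioi 0)) :
    Integrable (localPriorDensity a L) := by
  rw [localPriorDensity_eq_indicator]
  exact IntegrableOn.integrable_indicator (Integrable.const_mul hprior _) measurableSet_Ioi

lemma prior_normalizer_pos (hLpos : ∀ t, 0 < t → 0 < L t)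
    (hprior : IntegrableOn (fun t : ℝ => t ^ (-a - 1) * L t) (Set.Ioi 0)) :
    0 < ∫ s in Set.Ioi (0 : ℝ), s ^ (-a - 1) * L s := by
  have hpos : ∀ t ∈ Set.Ioi (0 : ℝ), 0 < t ^ (-a - 1) * L t := fun t ht =>
    mul_pos (Real.rpow_pos_of_pos ht _) (hLpos t ht)
  rw [setIntegral_pos_iff_support_of_nonneg_ae
    ((ae_restrict_mem measurableSet_Ioi).mono fun t ht => (hpos t ht).le) hprior]
  have : Function.support (fun t : ℝ => t ^ (-a - 1) * L t) ∩ Set.Ioi 0 = Set.Ioi 0 :=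
    Set.inter_eq_right.2 fun t ht => (hpos t ht).ne'
  rw [this]
  simp

lemma localPriorDensity_pos (hLpos : ∀ t, 0 < t → 0 < L t)
    (hprior : IntegrableOn (fun t : ℝ => t ^ (-a - 1) * L t) (Set.Ioi 0)) {t : ℝ} (ht : 0 < t) :
    0 < localPriorDensity a L t := by
  rw [localPriorDensity, if_pos ht]
  exact mul_pos (inv_pos.2 (prior_normalizer_pos hLpos hprior))
    (mul_pos (Real.rpow_pos_of_pos ht _) (hLpos t ht))

lemma localPriorDensity_of_nonpos {t : ℝ} (ht : t ≤ 0) : localPriorDensity a L t = 0 := by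
  rw [localPriorDensity, if_neg ht.not_gt]

lemma localPriorDensity_nonneg (hLpos : ∀ t, 0 < t → 0 < L t)
    (hprior : IntegrableOn (fun t : ℝ => t ^ (-a - 1) * L t) (Set.Ioi 0)) (t : ℝ) :
    0 ≤ localPriorDensity a L t := by
  rcases lt_or_ge 0 t with ht | ht
  · exact (localPriorDensity_pos hLpos hprior ht).le
  · rw [localPriorDensity_of_nonpos ht]

end PriorDensity

/-! ### The one-dimensional posterior kernel -/

section PosteriorKernel

/-- Up to a constant, the posterior density at `t = λ²` for a group of size `m` with test
statistic `w`. -/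
noncomputable def postKernel (a : ℝ) (L : ℝ → ℝ) (m : ℕ) (w τ t : ℝ) : ℝ :=
  localPriorDensity a L t * ((√(1 + t * τ ^ 2) ^ m)⁻¹ * Real.exp ((1 - shrinkage τ t) * w / 2))

variable {a : ℝ} {L : ℝ → ℝ}

lemma shrinkage_pos {τ t : ℝ} (ht : 0 ≤ t) : 0 < shrinkage τ t := by
  unfold shrinkage; positivity

lemma shrinkage_le_one {τ t : ℝ} (ht : 0 ≤ t) : shrinkage τ t ≤ 1 := by
  unfold shrinkage
  rw [div_le_one (by positivity)]
  nlinarith [sq_nonneg τ, mul_nonneg ht (sq_nonneg τ)]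

lemma measurable_shrinkage (τ : ℝ) : Measurable (shrinkage τ) := by
  unfold shrinkage; fun_prop

lemma postKernel_of_nonpos {m : ℕ} {w τ t : ℝ} (ht : t ≤ 0) : postKernel a L m w τ t = 0 := by
  rw [postKernel, localPriorDensity_of_nonpos ht, zero_mul]

lemma postKernel_pos (hLpos : ∀ t, 0 < t → 0 < L t)
    (hprior : IntegrableOn (fun t : ℝ => t ^ (-a - 1) * L t) (Set.Ioi 0)) (m : ℕ) (w τ : ℝ)
    {t : ℝ} (ht : 0 < t) : 0 < postKernel a L m w τ t := by
  have := localPriorDensity_pos hLpos hprior ht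
  unfold postKernel; positivity

lemma postKernel_nonneg (hLpos : ∀ t, 0 < t → 0 < L t)
    (hprior : IntegrableOn (fun t : ℝ => t ^ (-a - 1) * L t) (Set.Ioi 0)) (m : ℕ) (w τ t : ℝ) :
    0 ≤ postKernel a L m w τ t := by
  rcases lt_or_ge 0 t with ht | ht
  · exact (postKernel_pos hLpos hprior m w τ ht).le
  · rw [postKernel_of_nonpos ht]

/-- For `w ≥ 0` the factor multiplying the prior density is at most `exp (w / 2)`, so properness of
the prior suffices. -/
lemma integrable_postKernel (hLpos : ∀ t, 0 < t → 0 < L t)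
    (hprior : IntegrableOn (fun t : ℝ => t ^ (-a - 1) * L t) (Set.Ioi 0)) (m : ℕ) {w : ℝ}
    (hw : 0 ≤ w) (τ : ℝ) : Integrable (postKernel a L m w τ) := by
  have hint := integrable_localPriorDensity hprior
  refine (hint.mul_const (Real.exp (w / 2))).mono' ?_ ?_
  · unfold postKernel
    have := measurable_shrinkage τ
    exact hint.aestronglyMeasurable.mul (Measurable.aestronglyMeasurable (by fun_prop))
  · refine ae_of_all _ fun t => ?_
    rw [Real.norm_of_nonneg (postKernel_nonneg hLpos hprior m w τ t)]
    rcases lt_or_ge 0 t with ht | ht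
    · refine mul_le_mul_of_nonneg_left ?_ (localPriorDensity_nonneg hLpos hprior t)
      have h1 : (√(1 + t * τ ^ 2) ^ m)⁻¹ ≤ 1 := by
        refine inv_le_one_of_one_le₀ (one_le_pow₀ (Real.one_le_sqrt.2 ?_))
        nlinarith [mul_nonneg ht.le (sq_nonneg τ)]
      have h2 : Real.exp ((1 - shrinkage τ t) * w / 2) ≤ Real.exp (w / 2) := by
        rw [Real.exp_le_exp]
        nlinarith [mul_nonneg (shrinkage_pos (τ := τ) ht.le).le hw]
      calc _ ≤ 1 * Real.exp (w / 2) := by gcongr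
        _ = _ := one_mul _
    · rw [postKernel_of_nonpos ht, localPriorDensity_of_nonpos ht, zero_mul]

lemma integrable_weight_mul_postKernel (hLpos : ∀ t, 0 < t → 0 < L t)
    (hprior : IntegrableOn (fun t : ℝ => t ^ (-a - 1) * L t) (Set.Ioi 0)) (m : ℕ) {w : ℝ}
    (hw : 0 ≤ w) (τ : ℝ) :
    Integrable fun t => (1 - shrinkage τ t) * postKernel a L m w τ t := by
  have hint := integrable_postKernel hLpos hprior m hw τ
  refine hint.mono ?_ (ae_of_all _ fun t => ?_)
  · have := measurable_shrinkage τ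
    exact (Measurable.aestronglyMeasurable (by fun_prop)).mul hint.aestronglyMeasurable
  · rcases lt_or_ge 0 t with ht | ht
    · rw [norm_mul]
      refine mul_le_of_le_one_left (norm_nonneg _) ?_
      rw [Real.norm_eq_abs, abs_le]
      constructor <;> linarith [shrinkage_pos (τ := τ) ht.le, shrinkage_le_one (τ := τ) ht.le]
    · simp [postKernel_of_nonpos ht]

lemma integral_postKernel_pos (hLpos : ∀ t, 0 < t → 0 < L t)
    (hprior : IntegrableOn (fun t : ℝ => t ^ (-a - 1) * L t) (Set.Ioi 0)) (m : ℕ) {w : ℝ}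
    (hw : 0 ≤ w) (τ : ℝ) : 0 < ∫ t, postKernel a L m w τ t := by
  rw [integral_pos_iff_support_of_nonneg (postKernel_nonneg hLpos hprior m w τ)
    (integrable_postKernel hLpos hprior m hw τ)]
  refine lt_of_lt_of_le ?_ (measure_mono (s := Set.Ioi (0 : ℝ)) fun t ht =>
    (postKernel_pos hLpos hprior m w τ ht).ne')
  simp

end PosteriorKernel

/-! ### Factorization of the posterior over groups -/

namespace GroupDesign

variable {n : ℕ} {D : GroupDesign n}

/-- The Gram matrix `X_gᵀ X_g`. -/
def gram (D : GroupDesign n) (g : Fin D.G) : Matrix (Fin (D.size g)) (Fin (D.size g)) ℝ :=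
  (D.X g)ᵀ * D.X g

lemma dotProduct_gram_mulVec (g : Fin D.G) (u v : Fin (D.size g) → ℝ) :
    u ⬝ᵥ (D.gram g *ᵥ v) = (D.X g *ᵥ u) ⬝ᵥ (D.X g *ᵥ v) := by
  rw [gram, ← mulVec_mulVec, dotProduct_mulVec, vecMul_transpose]

lemma gram_posDef {g : Fin D.G} (hrank : (D.X g).rank = D.size g) : (D.gram g).PosDef := by
  have h := PosDef.conjTranspose_mul_self (D.X g) (?_)
  · rwa [conjTranspose_eq_transpose_of_trivial] at h
  · rw [mulVec_injective_iff]
    rw [rank_eq_finrank_span_cols] at hrank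
    exact linearIndependent_iff_card_eq_finrank_span.2 (by simp [Set.finrank, hrank])

lemma gram_mulVec_lse {g : Fin D.G} (hrank : (D.X g).rank = D.size g) (y : Fin n → ℝ) :
    D.gram g *ᵥ D.lse y g = (D.X g)ᵀ *ᵥ y := by
  have hu := (D.gram g).isUnit_iff_isUnit_det.1 (gram_posDef hrank).isUnit
  rw [lse, ← gram, mulVec_mulVec, mul_nonsing_inv _ hu, one_mulVec]

/-- By the normal equations, the likelihood of a group sees `y` only through the least squares
estimate. -/
lemma dotProduct_X_mulVec {g : Fin D.G} (hrank : (D.X g).rank = D.size g) (y : Fin n → ℝ)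
    (b : Fin (D.size g) → ℝ) :
    y ⬝ᵥ (D.X g *ᵥ b) = D.lse y g ⬝ᵥ (D.gram g *ᵥ b) := by
  rw [dotProduct_mulVec_comm_of_isHermitian (gram_posDef hrank).isHermitian, gram_mulVec_lse hrank,
    dotProduct_comm b, dotProduct_mulVec, ← mulVec_transpose]

lemma W_eq (hn : n ≠ 0) (σ : ℝ) (y : Fin n → ℝ) (g : Fin D.G) :
    D.W σ y g = quad (D.gram g) (D.lse y g) / σ ^ 2 := by
  have : (n : ℝ) ≠ 0 := by exact_mod_cast hn
  rw [W, Q, quad, gram, smul_mulVec, dotProduct_smul, smul_eq_mul, mul_inv_cancel_left₀ this]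

lemma W_nonneg (σ : ℝ) (y : Fin n → ℝ) {g : Fin D.G} (hrank : (D.X g).rank = D.size g) :
    0 ≤ D.W σ y g := by
  rcases eq_or_ne n 0 with h | h
  · simp [W, h]
  · rw [W_eq h]
    exact div_nonneg (quad_nonneg (gram_posDef hrank).posSemidef _) (sq_nonneg _)

lemma mean_dotProduct_mean (horth : D.BlockOrthogonal) (b : D.Coef) :
    D.mean b ⬝ᵥ D.mean b = ∑ g, quad (D.gram g) (b g) := by
  unfold mean
  rw [sum_dotProduct]
  refine Finset.sum_congr rfl fun g _ => ?_
  rw [dotProduct_sum, Finset.sum_eq_single g]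
  · rw [quad, dotProduct_gram_mulVec]
  · intro h _ hne
    rw [dotProduct_mulVec, ← mulVec_transpose, mulVec_mulVec, horth h g hne]
    simp
  · simp

/-- The contribution of one group to the joint density. -/
noncomputable def groupDensity (D : GroupDesign n) (a : ℝ) (L : ℝ → ℝ) (σ τ : ℝ) (y : Fin n → ℝ)
    (g : Fin D.G) (t : ℝ) (b : Fin (D.size g) → ℝ) : ℝ :=
  localPriorDensity a L t *
    (mvNormalDensity 0 ((t * σ ^ 2 * τ ^ 2) • ((D.X g)ᵀ * D.X g)⁻¹) b *
      Real.exp ((2 * (y ⬝ᵥ (D.X g *ᵥ b)) - quad (D.gram g) b) / (2 * σ ^ 2)))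

/-- Expanding `|y - Xβ|²`, orthogonality removes the cross terms between groups; the term `y ⬝ᵥ y`
and the normalization of the likelihood go into `C`. -/
lemma exists_jointDensity_eq (horth : D.BlockOrthogonal) (a : ℝ) (L : ℝ → ℝ) {σ : ℝ}
    (hσ : 0 < σ) (τ : ℝ) (y : Fin n → ℝ) :
    ∃ C : ℝ, C ≠ 0 ∧ ∀ v b, D.jointDensity a L σ τ v b y =
      C * ∏ g, D.groupDensity a L σ τ y g (v g) (b g) := by
  refine ⟨(√((2 * Real.pi) ^ n * (σ ^ 2 • (1 : Matrix (Fin n) (Fin n) ℝ)).det))⁻¹ *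
    Real.exp (-(y ⬝ᵥ y) / (2 * σ ^ 2)), ?_, fun v b => ?_⟩
  · have : 0 < (σ ^ 2 • (1 : Matrix (Fin n) (Fin n) ℝ)).det := by
      rw [det_smul, det_one, mul_one]; positivity
    have := Real.pi_pos
    positivity
  · simp only [groupDensity, Finset.prod_mul_distrib, jointDensity]
    rw [← Real.exp_sum, mvNormalDensity]
    have hinv : (σ ^ 2 • (1 : Matrix (Fin n) (Fin n) ℝ))⁻¹ = (σ ^ 2)⁻¹ • 1 := by
      refine inv_eq_left_inv ?_
      rw [smul_mul_smul_comm, one_mul, inv_mul_cancel₀ (by positivity), one_smul]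
    have hexp : -((y - D.mean b) ⬝ᵥ ((σ ^ 2 • (1 : Matrix (Fin n) (Fin n) ℝ))⁻¹ *ᵥ
        (y - D.mean b))) / 2 = -(y ⬝ᵥ y) / (2 * σ ^ 2) +
        ∑ g, (2 * (y ⬝ᵥ (D.X g *ᵥ b g)) - quad (D.gram g) (b g)) / (2 * σ ^ 2) := by
      rw [hinv, smul_mulVec, one_mulVec, dotProduct_smul, smul_eq_mul, ← Finset.sum_div,
        Finset.sum_sub_distrib, ← Finset.mul_sum, ← mean_dotProduct_mean horth, ← dotProduct_sum]
      change _ = _ + (2 * (y ⬝ᵥ D.mean b) - _) / _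
      rw [sub_dotProduct, dotProduct_sub, dotProduct_sub, dotProduct_comm (D.mean b) y]
      field_simp
      ring
    rw [hexp, Real.exp_add]
    ring

/-- Fubini for product integrands. As `C` is fixed before `ψ`, it is common to the numerator and the
denominator of a posterior expectation and cancels. -/
lemma integral_prod_mul_jointDensity (horth : D.BlockOrthogonal) (a : ℝ) (L : ℝ → ℝ) {σ : ℝ}
    (hσ : 0 < σ) (τ : ℝ) (y : Fin n → ℝ) :
    ∃ C : ℝ, C ≠ 0 ∧ ∀ ψ : (g : Fin D.G) → ℝ → (Fin (D.size g) → ℝ) → ℝ,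
      ∫ v : Fin D.G → ℝ, ∫ b : D.Coef, (∏ g, ψ g (v g) (b g)) * D.jointDensity a L σ τ v b y =
      C * ∏ g, ∫ t, ∫ b, ψ g t b * D.groupDensity a L σ τ y g t b := by
  obtain ⟨C, hC, h⟩ := exists_jointDensity_eq horth a L hσ τ y
  refine ⟨C, hC, fun ψ => ?_⟩
  have h1 : ∀ v : Fin D.G → ℝ,
      ∫ b : D.Coef, (∏ g, ψ g (v g) (b g)) * D.jointDensity a L σ τ v b y =
      C * ∏ g, ∫ b, ψ g (v g) b * D.groupDensity a L σ τ y g (v g) b := by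
    intro v
    rw [← integral_fintype_prod_volume_eq_prod, ← integral_const_mul]
    congr 1
    ext b
    rw [h, Finset.prod_mul_distrib]
    ring
  simp only [h1]
  rw [integral_const_mul]
  congr 1
  exact integral_fintype_prod_volume_eq_prod
    (fun (g : Fin D.G) (t : ℝ) => ∫ b, ψ g t b * D.groupDensity a L σ τ y g t b)

lemma postExp_eq_div (horth : D.BlockOrthogonal) (a : ℝ) (L : ℝ → ℝ) {σ : ℝ}
    (hσ : 0 < σ) (τ : ℝ) (y : Fin n → ℝ)
    (hne : ∀ g, ∫ t, ∫ b, D.groupDensity a L σ τ y g t b ≠ 0) (g : Fin D.G)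
    (ψ : ℝ → (Fin (D.size g) → ℝ) → ℝ) :
    D.postExp a L σ τ y (fun v b => ψ (v g) (b g)) =
      (∫ t, ∫ b, ψ t b * D.groupDensity a L σ τ y g t b) /
        ∫ t, ∫ b, D.groupDensity a L σ τ y g t b := by
  obtain ⟨C, hC, h⟩ := integral_prod_mul_jointDensity horth a L hσ τ y
  have hone := h fun _ _ _ => 1
  -- A function of group `g` alone is a product whose other factors are `1`, so the integrals of the
  -- other groups cancel.
  have hψ := h (Function.update (fun _ _ _ => 1) g ψ)
  have hprod : ∀ (v : Fin D.G → ℝ) (b : D.Coef),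
      ∏ h, Function.update (fun h (_ : ℝ) (_ : Fin (D.size h) → ℝ) => (1 : ℝ)) g ψ h (v h) (b h) =
      ψ (v g) (b g) := by
    intro v b
    rw [Finset.prod_eq_single g]
    · rw [Function.update_self]
    · intro h _ hh
      rw [Function.update_of_ne hh]
    · simp
  simp only [hprod] at hψ
  simp only [Finset.prod_const_one, one_mul] at hone
  rw [postExp, hψ, hone, mul_div_mul_left _ _ hC, ← Finset.mul_prod_erase _ _ (Finset.mem_univ g),
    ← Finset.mul_prod_erase _ _ (Finset.mem_univ g), Function.update_self]
  have herase : ∏ h ∈ Finset.univ.erase g, ∫ t, ∫ b,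
      Function.update (fun h (_ : ℝ) (_ : Fin (D.size h) → ℝ) => (1 : ℝ)) g ψ h t b *
        D.groupDensity a L σ τ y h t b =
      ∏ h ∈ Finset.univ.erase g, ∫ t, ∫ b, D.groupDensity a L σ τ y h t b := by
    refine Finset.prod_congr rfl fun h hh => ?_
    rw [Function.update_of_ne (Finset.ne_of_mem_erase hh)]
    simp
  rw [herase, mul_div_mul_right]
  exact Finset.prod_ne_zero_iff.2 fun h _ => hne h

/-- Prior and likelihood exponents are multiples of the same quadratic form, so their precisions `(t
* σ ^ 2 * τ ^ 2)⁻¹` and `(σ ^ 2)⁻¹` simply add. -/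
lemma groupDensity_eq {a : ℝ} {L : ℝ → ℝ} {σ τ t : ℝ} (hσ : 0 < σ) (hτ : 0 < τ) (ht : 0 < t)
    {g : Fin D.G} (hrank : (D.X g).rank = D.size g) (y : Fin n → ℝ)
    (b : Fin (D.size g) → ℝ) :
    D.groupDensity a L σ τ y g t b = localPriorDensity a L t *
      ((√((2 * Real.pi) ^ D.size g * (D.gram g)⁻¹.det))⁻¹ * (√(t * σ ^ 2 * τ ^ 2) ^ D.size g)⁻¹) *
      Real.exp ((σ ^ 2)⁻¹ * (D.lse y g ⬝ᵥ (D.gram g *ᵥ b)) -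
        ((σ ^ 2)⁻¹ + (t * σ ^ 2 * τ ^ 2)⁻¹) * quad (D.gram g) b / 2) := by
  have hp : 0 < t * σ ^ 2 * τ ^ 2 := by positivity
  have hA := gram_posDef hrank
  have hu := (D.gram g).isUnit_iff_isUnit_det.1 hA.isUnit
  have hinv : ((t * σ ^ 2 * τ ^ 2) • (D.gram g)⁻¹)⁻¹ = (t * σ ^ 2 * τ ^ 2)⁻¹ • D.gram g := by
    refine inv_eq_left_inv ?_
    rw [smul_mul_smul_comm, mul_nonsing_inv _ hu, inv_mul_cancel₀ hp.ne', one_smul]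
  rw [groupDensity, ← gram, dotProduct_X_mulVec hrank, mvNormalDensity, hinv, sub_zero,
    smul_mulVec, dotProduct_smul, smul_eq_mul, det_smul, Fintype.card_fin]
  have hsq : √((2 * Real.pi) ^ D.size g * ((t * σ ^ 2 * τ ^ 2) ^ D.size g * (D.gram g)⁻¹.det)) =
      √((2 * Real.pi) ^ D.size g * (D.gram g)⁻¹.det) * √(t * σ ^ 2 * τ ^ 2) ^ D.size g := by
    rw [show (2 * Real.pi) ^ D.size g * ((t * σ ^ 2 * τ ^ 2) ^ D.size g * (D.gram g)⁻¹.det) =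
      ((t * σ ^ 2 * τ ^ 2) ^ D.size g) * ((2 * Real.pi) ^ D.size g * (D.gram g)⁻¹.det) by ring,
      Real.sqrt_mul (by positivity), mul_comm]
    congr 1
    rw [Real.sqrt_eq_iff_mul_self_eq (by positivity) (by positivity), ← mul_pow,
      Real.mul_self_sqrt hp.le]
  rw [hsq, mul_inv, mul_assoc _ _ (Real.exp _), ← Real.exp_add, ← mul_assoc, ← quad]
  congr 2
  field_simp
  ring

/-- The normalizing constant of the posterior of a group. -/
noncomputable def groupConst (D : GroupDesign n) (g : Fin D.G) : ℝ :=
  (√((2 * Real.pi) ^ D.size g * (D.gram g)⁻¹.det))⁻¹ * gaussMass (D.gram g)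

lemma groupConst_pos {g : Fin D.G} (hrank : (D.X g).rank = D.size g) : 0 < D.groupConst g := by
  have hA := gram_posDef hrank
  have h1 := hA.inv.det_pos
  have h2 := gaussMass_pos hA
  have := Real.pi_pos
  unfold groupConst
  positivity

/-- The determinant factors combine because `(t σ² τ²) (σ⁻² + (t σ² τ²)⁻¹) = 1 + t τ²`; everything
independent of `t` is collected in `groupConst`. -/
lemma postKernel_eq (hn : n ≠ 0) {a : ℝ} {L : ℝ → ℝ} {σ τ t : ℝ} (hσ : 0 < σ) (hτ : 0 < τ)
    (ht : 0 < t) (g : Fin D.G) (y : Fin n → ℝ) :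
    localPriorDensity a L t *
      ((√((2 * Real.pi) ^ D.size g * (D.gram g)⁻¹.det))⁻¹ * (√(t * σ ^ 2 * τ ^ 2) ^ D.size g)⁻¹) *
      (Real.exp (((σ ^ 2)⁻¹) ^ 2 * quad (D.gram g) (D.lse y g) /
          (2 * ((σ ^ 2)⁻¹ + (t * σ ^ 2 * τ ^ 2)⁻¹))) *
        ((√((σ ^ 2)⁻¹ + (t * σ ^ 2 * τ ^ 2)⁻¹) ^ D.size g)⁻¹ * gaussMass (D.gram g))) =
      D.groupConst g * postKernel a L (D.size g) (D.W σ y g) τ t := by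
  have hsqrt : √(1 + t * τ ^ 2) ^ D.size g =
      √(t * σ ^ 2 * τ ^ 2) ^ D.size g * √((σ ^ 2)⁻¹ + (t * σ ^ 2 * τ ^ 2)⁻¹) ^ D.size g := by
    rw [← mul_pow, ← Real.sqrt_mul (by positivity)]
    congr 2
    field_simp
    ring
  have hexp : ((σ ^ 2)⁻¹) ^ 2 * quad (D.gram g) (D.lse y g) /
      (2 * ((σ ^ 2)⁻¹ + (t * σ ^ 2 * τ ^ 2)⁻¹)) = (1 - shrinkage τ t) * D.W σ y g / 2 := by
    rw [W_eq hn, shrinkage]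
    field_simp
    ring
  rw [postKernel, hexp, hsqrt, mul_inv, groupConst]
  ring

lemma integral_groupDensity (hn : n ≠ 0) {a : ℝ} {L : ℝ → ℝ} {σ τ : ℝ} (hσ : 0 < σ) (hτ : 0 < τ)
    {g : Fin D.G} (hrank : (D.X g).rank = D.size g) (y : Fin n → ℝ) (t : ℝ) :
    ∫ b, D.groupDensity a L σ τ y g t b =
      D.groupConst g * postKernel a L (D.size g) (D.W σ y g) τ t := by
  rcases lt_or_ge 0 t with ht | ht
  · have hc : 0 < (σ ^ 2)⁻¹ + (t * σ ^ 2 * τ ^ 2)⁻¹ := by positivity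
    simp only [groupDensity_eq hσ hτ ht hrank]
    rw [integral_const_mul, integral_exp_linear_sub_quad (gram_posDef hrank) _ hc,
      postKernel_eq hn hσ hτ ht]
  · simp [groupDensity, localPriorDensity_of_nonpos ht, postKernel_of_nonpos ht]

lemma integral_coord_mul_groupDensity (hn : n ≠ 0) {a : ℝ} {L : ℝ → ℝ} {σ τ : ℝ} (hσ : 0 < σ)
    (hτ : 0 < τ) {g : Fin D.G} (hrank : (D.X g).rank = D.size g) (y : Fin n → ℝ) (t : ℝ)
    (j : Fin (D.size g)) :
    ∫ b, b j * D.groupDensity a L σ τ y g t b = D.groupConst g * D.lse y g j *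
      ((1 - shrinkage τ t) * postKernel a L (D.size g) (D.W σ y g) τ t) := by
  rcases lt_or_ge 0 t with ht | ht
  · have hc : 0 < (σ ^ 2)⁻¹ + (t * σ ^ 2 * τ ^ 2)⁻¹ := by positivity
    simp only [groupDensity_eq hσ hτ ht hrank,
      mul_left_comm _ (localPriorDensity a L t * _)]
    rw [integral_const_mul, integral_coord_mul_exp_linear_sub_quad (gram_posDef hrank) _ hc,
      mul_left_comm, postKernel_eq hn hσ hτ ht]
    have : (σ ^ 2)⁻¹ / ((σ ^ 2)⁻¹ + (t * σ ^ 2 * τ ^ 2)⁻¹) = 1 - shrinkage τ t := by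
      rw [shrinkage]
      field_simp
      ring
    rw [this]
    ring
  · simp [groupDensity, localPriorDensity_of_nonpos ht, postKernel_of_nonpos ht]

section Posterior

variable {a : ℝ} {L : ℝ → ℝ} {σ τ : ℝ}

lemma integral_integral_groupDensity_ne_zero (hLpos : ∀ t, 0 < t → 0 < L t)
    (hprior : IntegrableOn (fun t : ℝ => t ^ (-a - 1) * L t) (Set.Ioi 0))
    (hn : n ≠ 0) (hσ : 0 < σ) (hτ : 0 < τ) {g : Fin D.G}
    (hrank : (D.X g).rank = D.size g) (y : Fin n → ℝ) :
    ∫ t, ∫ b, D.groupDensity a L σ τ y g t b ≠ 0 := by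
  simp only [integral_groupDensity hn hσ hτ hrank]
  rw [integral_const_mul]
  exact (mul_pos (groupConst_pos hrank)
    (integral_postKernel_pos hLpos hprior _ (W_nonneg σ y hrank) τ)).ne'

/-- The posterior expectation of `1 - κ_g` is a ratio of one-dimensional integrals. -/
lemma postWeight_eq (hLpos : ∀ t, 0 < t → 0 < L t)
    (hprior : IntegrableOn (fun t : ℝ => t ^ (-a - 1) * L t) (Set.Ioi 0))
    (hn : n ≠ 0) (hσ : 0 < σ) (hτ : 0 < τ) (horth : D.BlockOrthogonal)
    (hrank : ∀ g, (D.X g).rank = D.size g) (y : Fin n → ℝ) (g : Fin D.G) :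
    D.postWeight a L σ τ y g =
      (∫ t, (1 - shrinkage τ t) * postKernel a L (D.size g) (D.W σ y g) τ t) /
        ∫ t, postKernel a L (D.size g) (D.W σ y g) τ t := by
  rw [postWeight, postExp_eq_div horth a L hσ τ y
    (fun h => integral_integral_groupDensity_ne_zero hLpos hprior hn hσ hτ (hrank h) y) g
    (fun t _ => 1 - shrinkage τ t)]
  simp only [integral_const_mul, integral_groupDensity hn hσ hτ (hrank g),
    mul_left_comm (_ : ℝ) (D.groupConst g)]
  rw [mul_div_mul_left _ _ (groupConst_pos (hrank g)).ne']

/-- The posterior mean shrinks the least squares estimate by the factor `E (1 - κ_g)`. -/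
lemma postMean_eq (hLpos : ∀ t, 0 < t → 0 < L t)
    (hprior : IntegrableOn (fun t : ℝ => t ^ (-a - 1) * L t) (Set.Ioi 0))
    (hn : n ≠ 0) (hσ : 0 < σ) (hτ : 0 < τ) (horth : D.BlockOrthogonal)
    (hrank : ∀ g, (D.X g).rank = D.size g) (y : Fin n → ℝ) (g : Fin D.G) :
    D.postMean a L σ τ y g = D.postWeight a L σ τ y g • D.lse y g := by
  ext j
  rw [postWeight_eq hLpos hprior hn hσ hτ horth hrank, postMean, postExp_eq_div horth a L hσ τ y
    (fun h => integral_integral_groupDensity_ne_zero hLpos hprior hn hσ hτ (hrank h) y) g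
    (fun _ b => b j)]
  simp only [integral_groupDensity hn hσ hτ (hrank g), integral_const_mul,
    integral_coord_mul_groupDensity hn hσ hτ (hrank g)]
  rw [mul_assoc, mul_div_mul_left _ _ (groupConst_pos (hrank g)).ne', Pi.smul_apply, smul_eq_mul]
  ring

end Posterior

end GroupDesign

/-! ### Deterministic bounds for the posterior weight -/

section WeightBounds

variable {a : ℝ} {L : ℝ → ℝ}

/-- Below `1` the power is at most `1`; beyond `1`, boundedness of `L` leaves the tail `t ^ (α - a -
1)`. This is what restricts the rate to `α < a`. -/
lemma integrable_rpow_mul_localPriorDensity (hLpos : ∀ t, 0 < t → 0 < L t)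
    (hprior : IntegrableOn (fun t : ℝ => t ^ (-a - 1) * L t) (Set.Ioi 0))
    {M : ℝ} (hM : ∀ t, 0 < t → L t ≤ M) {α : ℝ} (hα : 0 < α) (hαa : α < a) :
    Integrable fun t => t ^ α * localPriorDensity a L t := by
  have hint := integrable_localPriorDensity hprior
  have hZ := prior_normalizer_pos hLpos hprior
  set Z := ∫ s in Set.Ioi (0 : ℝ), s ^ (-a - 1) * L s with hZdef
  have htail : IntegrableOn (fun t : ℝ => Z⁻¹ * M * t ^ (α - a - 1)) (Set.Ioi 1) :=
    (integrableOn_Ioi_rpow_of_lt (by linarith) one_pos).const_mul _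
  refine (hint.add (htail.integrable_indicator measurableSet_Ioi)).mono' ?_
    (ae_of_all _ fun t => ?_)
  · exact (Measurable.aestronglyMeasurable (by fun_prop)).mul hint.aestronglyMeasurable
  · have hnn := localPriorDensity_nonneg hLpos hprior t
    have hMpos : 0 < M := (hLpos 1 one_pos).trans_le (hM 1 one_pos)
    rcases le_or_gt t 0 with ht | ht
    · simp only [localPriorDensity_of_nonpos ht, mul_zero, norm_zero, Pi.add_apply, zero_add]
      exact Set.indicator_nonneg (fun t (h : 1 < t) => by positivity) t
    rw [Real.norm_of_nonneg (by positivity), Pi.add_apply]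
    rcases le_or_gt t 1 with h1 | h1
    · rw [Set.indicator_of_notMem (by simpa using h1), add_zero]
      exact mul_le_of_le_one_left hnn (Real.rpow_le_one ht.le h1 hα.le)
    · rw [Set.indicator_of_mem (by simpa using h1)]
      refine le_add_of_nonneg_of_le hnn ?_
      rw [localPriorDensity, if_pos ht, ← hZdef,
        show α - a - 1 = α + (-a - 1) by ring, Real.rpow_add ht]
      have := hM t ht
      have h2 : 0 ≤ t ^ α * Z⁻¹ * t ^ (-a - 1) := by positivity
      nlinarith [mul_le_mul_of_nonneg_left this h2]

/-- With a small test statistic and a small global parameter, the posterior weight is small. -/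
lemma exists_weight_upper_bound (hLpos : ∀ t, 0 < t → 0 < L t)
    (hprior : IntegrableOn (fun t : ℝ => t ^ (-a - 1) * L t) (Set.Ioi 0))
    {M : ℝ} (hM : ∀ t, 0 < t → L t ≤ M) {α : ℝ} (hα : 0 < α) (hα1 : α ≤ 1) (hαa : α < a)
    (s : ℕ) :
    ∃ C : ℝ, ∀ m ≤ s, ∀ w τ : ℝ, 0 ≤ w → 0 < τ → τ ≤ 1 →
      (∫ t, (1 - shrinkage τ t) * postKernel a L m w τ t) / (∫ t, postKernel a L m w τ t) ≤
        C * ((τ ^ 2) ^ α * Real.exp (w / 2)) := by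
  have hint := integrable_rpow_mul_localPriorDensity hLpos hprior hM hα hαa
  have hd0 := integral_postKernel_pos hLpos hprior s le_rfl 1
  refine ⟨(∫ t, t ^ α * localPriorDensity a L t) / ∫ t, postKernel a L s 0 1 t,
    fun m hm w τ hw hτ hτ1 => ?_⟩
  -- The kernel decreases in `m` and `τ` and increases in `w`, so the extreme case `m = s`, `τ = 1`,
  -- `w = 0` bounds every denominator from below.
  have hden : ∫ t, postKernel a L s 0 1 t ≤ ∫ t, postKernel a L m w τ t := by
    refine integral_mono (integrable_postKernel hLpos hprior s le_rfl 1)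
      (integrable_postKernel hLpos hprior m hw τ) fun t => ?_
    rcases le_or_gt t 0 with ht | ht
    · rw [postKernel_of_nonpos ht, postKernel_of_nonpos ht]
    refine mul_le_mul_of_nonneg_left ?_ (localPriorDensity_nonneg hLpos hprior t)
    rw [mul_zero, zero_div, Real.exp_zero, mul_one]
    have h1 : (√(1 + t * 1 ^ 2) ^ s)⁻¹ ≤ (√(1 + t * τ ^ 2) ^ m)⁻¹ := by
      have hτ2 : τ ^ 2 ≤ 1 ^ 2 := by gcongr
      have h0 : 1 ≤ √(1 + t * τ ^ 2) :=
        Real.one_le_sqrt.2 (by nlinarith [mul_pos ht (sq_pos_of_pos hτ)])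
      have h : √(1 + t * τ ^ 2) ^ m ≤ √(1 + t * 1 ^ 2) ^ s :=
        calc √(1 + t * τ ^ 2) ^ m ≤ √(1 + t * τ ^ 2) ^ s := pow_le_pow_right₀ h0 hm
          _ ≤ _ := by gcongr
      exact inv_anti₀ (by positivity) h
    have h2 : 1 ≤ Real.exp ((1 - shrinkage τ t) * w / 2) := by
      rw [Real.one_le_exp_iff]
      have := shrinkage_le_one (τ := τ) ht.le
      have : 0 ≤ (1 - shrinkage τ t) * w := mul_nonneg (by linarith) hw
      linarith
    calc _ ≤ (√(1 + t * τ ^ 2) ^ m)⁻¹ * 1 := by rw [mul_one]; exact h1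
      _ ≤ _ := by gcongr
  have hnum : ∫ t, (1 - shrinkage τ t) * postKernel a L m w τ t ≤
      ((τ ^ 2) ^ α * Real.exp (w / 2)) * ∫ t, t ^ α * localPriorDensity a L t := by
    rw [← integral_const_mul]
    refine integral_mono (integrable_weight_mul_postKernel hLpos hprior m hw τ)
      (hint.const_mul _) fun t => ?_
    rcases le_or_gt t 0 with ht | ht
    · simp [postKernel_of_nonpos ht, localPriorDensity_of_nonpos ht]
    have hκ0 := shrinkage_pos (τ := τ) ht.le
    have hκ1 := shrinkage_le_one (τ := τ) ht.le
    have hp := localPriorDensity_nonneg hLpos hprior (a := a) t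
    -- `1 - κ ≤ min 1 (τ² t) ≤ (τ² t)^α` since `0 < α ≤ 1`.
    have h1 : 1 - shrinkage τ t ≤ (τ ^ 2) ^ α * t ^ α := by
      rw [← Real.mul_rpow (by positivity) ht.le]
      have hle : 1 - shrinkage τ t ≤ τ ^ 2 * t := by
        rw [shrinkage, sub_le_iff_le_add, ← sub_le_iff_le_add', le_div_iff₀ (by positivity)]
        nlinarith [sq_nonneg (t * τ ^ 2)]
      rcases le_or_gt (τ ^ 2 * t) 1 with h | h
      · refine hle.trans ?_
        conv_lhs => rw [← Real.rpow_one (τ ^ 2 * t)]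
        exact Real.rpow_le_rpow_of_exponent_ge (by positivity) h hα1
      · exact (by linarith : 1 - shrinkage τ t ≤ 1).trans (Real.one_le_rpow h.le hα.le)
    have h2 : (√(1 + t * τ ^ 2) ^ m)⁻¹ ≤ 1 := by
      refine inv_le_one_of_one_le₀ (one_le_pow₀ (Real.one_le_sqrt.2 ?_))
      nlinarith [mul_nonneg ht.le (sq_nonneg τ)]
    have h3 : Real.exp ((1 - shrinkage τ t) * w / 2) ≤ Real.exp (w / 2) := by
      rw [Real.exp_le_exp]
      nlinarith [mul_nonneg hκ0.le hw]
    calc (1 - shrinkage τ t) * postKernel a L m w τ t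
        ≤ ((τ ^ 2) ^ α * t ^ α) * (localPriorDensity a L t * (1 * Real.exp (w / 2))) := by
          unfold postKernel; gcongr
      _ = _ := by ring
  rw [div_mul_eq_mul_div, mul_comm (∫ t, t ^ α * localPriorDensity a L t)]
  have hI : 0 ≤ ∫ t, t ^ α * localPriorDensity a L t := by
    refine integral_nonneg fun t => ?_
    rcases le_or_gt t 0 with ht | ht
    · simp [localPriorDensity_of_nonpos ht]
    · exact mul_nonneg (by positivity) (localPriorDensity_nonneg hLpos hprior t)
  exact div_le_div₀ (by positivity) hnum hd0 hden

/-- With a large test statistic, the posterior weight exceeds `3 / 4` up to a small error. -/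
lemma exists_weight_lower_bound (ha : 0 < a) (hLpos : ∀ t, 0 < t → 0 < L t)
    (hprior : IntegrableOn (fun t : ℝ => t ^ (-a - 1) * L t) (Set.Ioi 0))
    (hLlower : ∃ c₀ : ℝ, 0 < c₀ ∧ ∃ t₀ : ℝ, 0 < t₀ ∧ ∀ t, t₀ ≤ t → c₀ ≤ L t) (s : ℕ) :
    ∃ C : ℝ, ∀ m ≤ s, ∀ w τ : ℝ, 0 ≤ w → 0 < τ → τ ≤ 1 →
      3 / 4 - C * (((τ ^ 2) ^ a)⁻¹ * Real.exp (-(3 * w / 32))) ≤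
      (∫ t, (1 - shrinkage τ t) * postKernel a L m w τ t) / (∫ t, postKernel a L m w τ t) := by
  obtain ⟨c₀, hc₀, t₀, ht₀, hlow⟩ := hLlower
  have hint := integrable_localPriorDensity hprior
  have hZ := prior_normalizer_pos hLpos hprior
  set Z := ∫ s in Set.Ioi (0 : ℝ), s ^ (-a - 1) * L s with hZdef
  -- `t τ² ≥ 15` gives `κ ≤ 1/16`, and `t ≥ t₀` makes the lower bound on `L` available.
  set B := max 15 t₀ with hB
  have hB15 : 15 ≤ B := le_max_left _ _
  have hBt : t₀ ≤ B := le_max_right _ _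
  have hBpos : 0 < B := by linarith
  set k := Z⁻¹ * ((2 * B) ^ (-a - 1) * c₀) * (√(1 + 2 * B) ^ s)⁻¹ * B with hk
  have hkpos : 0 < k := by positivity
  refine ⟨(∫ t, localPriorDensity a L t) / k, fun m hm w τ hw hτ hτ1 => ?_⟩
  have hD := integral_postKernel_pos hLpos hprior m hw τ
  have hKint := integrable_postKernel hLpos hprior m hw τ
  have hτ2 : 0 < τ ^ 2 := by positivity
  have hτ21 : τ ^ 2 ≤ 1 := by nlinarith
  -- Where `κ ≤ 1/4` the weight is at least `3/4`; elsewhere the kernel itself is at most `exp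
  -- (3w/8)` times the prior density.
  have hsplit : ∫ t, (1 - shrinkage τ t) * postKernel a L m w τ t ≥
      3 / 4 * (∫ t, postKernel a L m w τ t) -
        Real.exp (3 * w / 8) * ∫ t, localPriorDensity a L t := by
    rw [← integral_const_mul, ← integral_const_mul,
      ← integral_sub (hKint.const_mul _) (hint.const_mul _)]
    refine integral_mono ((hKint.const_mul _).sub (hint.const_mul _))
      (integrable_weight_mul_postKernel hLpos hprior m hw τ) fun t => ?_
    rcases le_or_gt t 0 with ht | ht
    · simp [postKernel_of_nonpos ht, localPriorDensity_of_nonpos ht]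
    have hp := localPriorDensity_nonneg hLpos hprior (a := a) t
    have hK := postKernel_nonneg hLpos hprior m w τ t
    have hκ0 := shrinkage_pos (τ := τ) ht.le
    rcases le_or_gt (shrinkage τ t) (1 / 4) with h | h
    · have h1 : 0 ≤ Real.exp (3 * w / 8) * localPriorDensity a L t := by positivity
      have h2 := mul_le_mul_of_nonneg_right (by linarith : 3 / 4 ≤ 1 - shrinkage τ t) hK
      simp only
      linarith
    · have h2 : (√(1 + t * τ ^ 2) ^ m)⁻¹ ≤ 1 := by
        refine inv_le_one_of_one_le₀ (one_le_pow₀ (Real.one_le_sqrt.2 ?_))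
        nlinarith [mul_nonneg ht.le (sq_nonneg τ)]
      have h3 : Real.exp ((1 - shrinkage τ t) * w / 2) ≤ Real.exp (3 * w / 8) := by
        rw [Real.exp_le_exp]
        nlinarith [mul_nonneg (by linarith : 0 ≤ shrinkage τ t - 1 / 4) hw]
      have h4 : postKernel a L m w τ t ≤ Real.exp (3 * w / 8) * localPriorDensity a L t := by
        calc postKernel a L m w τ t
            ≤ localPriorDensity a L t * (1 * Real.exp (3 * w / 8)) := by
              unfold postKernel; gcongr
          _ = _ := by ring
      have h5 : 0 ≤ (1 - shrinkage τ t) * postKernel a L m w τ t :=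
        mul_nonneg (by linarith [shrinkage_le_one (τ := τ) ht.le]) hK
      simp only
      linarith
  -- The window `B ≤ t τ² ≤ 2B` has prior mass of order at least `τ^(2a)`, and `κ ≤ 1/16` there
  -- gives the exponent `15w/32`, larger than the `3w/8 = 12w/32` of the error term.
  have hDlow : k * (τ ^ 2) ^ a * Real.exp (15 * w / 32) ≤ ∫ t, postKernel a L m w τ t := by
    have hpt : ∀ t ∈ Set.Icc (B / τ ^ 2) (2 * B / τ ^ 2),
        Z⁻¹ * ((2 * B / τ ^ 2) ^ (-a - 1) * c₀) *
          ((√(1 + 2 * B) ^ s)⁻¹ * Real.exp (15 * w / 32)) ≤ postKernel a L m w τ t := by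
      rintro t ⟨hl, hu⟩
      have hBle : B ≤ B / τ ^ 2 := le_div_self hBpos.le hτ2 hτ21
      have ht : 0 < t := by linarith
      rw [div_le_iff₀ hτ2] at hl
      rw [le_div_iff₀ hτ2] at hu
      have hL := hlow t (by linarith [div_le_iff₀ hτ2 |>.2 hl])
      have hrp : (2 * B / τ ^ 2) ^ (-a - 1) ≤ t ^ (-a - 1) :=
        Real.rpow_le_rpow_of_nonpos ht (le_div_iff₀ hτ2 |>.2 hu) (by linarith)
      have hsq : (√(1 + 2 * B) ^ s)⁻¹ ≤ (√(1 + t * τ ^ 2) ^ m)⁻¹ := by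
        have h0 : 1 ≤ √(1 + t * τ ^ 2) := Real.one_le_sqrt.2 (by linarith)
        have h : √(1 + t * τ ^ 2) ^ m ≤ √(1 + 2 * B) ^ s :=
          calc √(1 + t * τ ^ 2) ^ m ≤ √(1 + t * τ ^ 2) ^ s := pow_le_pow_right₀ h0 hm
            _ ≤ _ := by gcongr
        exact inv_anti₀ (by positivity) h
      have hκ : shrinkage τ t ≤ 1 / 16 := by
        rw [shrinkage]
        exact one_div_le_one_div_of_le (by norm_num) (by linarith)
      have hexp : Real.exp (15 * w / 32) ≤ Real.exp ((1 - shrinkage τ t) * w / 2) := by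
        rw [Real.exp_le_exp]
        nlinarith [mul_nonneg (by linarith : 0 ≤ 1 / 16 - shrinkage τ t) hw]
      have hLt := hLpos t ht
      rw [postKernel, localPriorDensity, if_pos ht, ← hZdef]
      gcongr
    have hvol : (volume (Set.Icc (B / τ ^ 2) (2 * B / τ ^ 2))) ≠ ⊤ := by simp
    calc k * (τ ^ 2) ^ a * Real.exp (15 * w / 32)
        = ∫ _ in Set.Icc (B / τ ^ 2) (2 * B / τ ^ 2), Z⁻¹ * ((2 * B / τ ^ 2) ^ (-a - 1) * c₀) *
          ((√(1 + 2 * B) ^ s)⁻¹ * Real.exp (15 * w / 32)) := by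
          rw [setIntegral_const, Real.volume_real_Icc_of_le (by gcongr; linarith), smul_eq_mul,
            Real.div_rpow (by positivity) hτ2.le, show -a - 1 = -(a + 1) by ring,
            Real.rpow_neg hτ2.le, Real.rpow_add_one hτ2.ne', hk, show -a - 1 = -(a + 1) by ring]
          field_simp
          ring
      _ ≤ ∫ t in Set.Icc (B / τ ^ 2) (2 * B / τ ^ 2), postKernel a L m w τ t :=
          setIntegral_mono_on (integrableOn_const hvol) hKint.integrableOn measurableSet_Icc hpt
      _ ≤ ∫ t, postKernel a L m w τ t :=
          setIntegral_le_integral hKint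
            (ae_of_all _ fun t => postKernel_nonneg hLpos hprior m w τ t)
  have hP : 0 ≤ ∫ t, localPriorDensity a L t :=
    integral_nonneg fun t => localPriorDensity_nonneg hLpos hprior t
  rw [le_div_iff₀ hD]
  refine le_trans ?_ hsplit
  have hx : Real.exp (3 * w / 8) = Real.exp (-(3 * w / 32)) * Real.exp (15 * w / 32) := by
    rw [← Real.exp_add]; ring_nf
  have h1 : Real.exp (3 * w / 8) * ∫ t, localPriorDensity a L t =
      (∫ t, localPriorDensity a L t) / k * (((τ ^ 2) ^ a)⁻¹ * Real.exp (-(3 * w / 32))) *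
        (k * (τ ^ 2) ^ a * Real.exp (15 * w / 32)) := by
    rw [hx]
    field_simp
  rw [h1]
  have h2 := mul_le_mul_of_nonneg_left hDlow (by positivity :
    0 ≤ (∫ t, localPriorDensity a L t) / k * (((τ ^ 2) ^ a)⁻¹ * Real.exp (-(3 * w / 32))))
  rw [sub_mul]
  linarith

end WeightBounds

/-! ### The noise statistics and their exponential moments -/

namespace GroupDesign

variable {n : ℕ} {D : GroupDesign n}

instance (D : GroupDesign n) (σ : ℝ) (b : D.Coef) : IsProbabilityMeasure (D.dataLaw σ b) := by
  unfold dataLaw; infer_instance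

lemma transpose_X_mulVec_mean (horth : D.BlockOrthogonal) (b : D.Coef) (g : Fin D.G) :
    (D.X g)ᵀ *ᵥ D.mean b = D.gram g *ᵥ b g := by
  rw [mean, mulVec_sum, Finset.sum_eq_single g]
  · rw [mulVec_mulVec, gram]
  · intro h _ hne
    rw [mulVec_mulVec, horth g h hne.symm, zero_mulVec]
  · simp

lemma lse_eq_add (horth : D.BlockOrthogonal) {g : Fin D.G}
    (hrank : (D.X g).rank = D.size g) (b : D.Coef) (y : Fin n → ℝ) :
    D.lse y g = b g + D.lse (y - D.mean b) g := by
  have hu := (D.gram g).isUnit_iff_isUnit_det.1 (gram_posDef hrank).isUnit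
  rw [lse, lse, mulVec_sub, mulVec_sub, transpose_X_mulVec_mean horth, ← gram, mulVec_mulVec (b g),
    nonsing_inv_mul _ hu, one_mulVec, add_sub_cancel]

lemma measurable_W (σ : ℝ) (g : Fin D.G) : Measurable fun y => D.W σ y g := by
  have : Continuous fun y => D.W σ y g := by
    unfold W lse
    fun_prop
  exact this.measurable

lemma lintegral_exp_dotProduct_dataLaw (D : GroupDesign n) {σ : ℝ} (hσ : 0 < σ) (b : D.Coef)
    (x : Fin n → ℝ) :
    ∫⁻ y, ENNReal.ofReal (Real.exp (σ⁻¹ * ((y - D.mean b) ⬝ᵥ x))) ∂D.dataLaw σ b =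
      ENNReal.ofReal (Real.exp ((x ⬝ᵥ x) / 2)) := by
  have heq : (fun y : Fin n → ℝ => Real.exp (σ⁻¹ * ((y - D.mean b) ⬝ᵥ x))) = fun y =>
      ∏ i, Real.exp (-(σ⁻¹ * x i * D.mean b i)) * Real.exp ((σ⁻¹ * x i) * y i) := by
    ext y
    simp only [← Real.exp_add, ← Real.exp_sum, dotProduct, Finset.mul_sum, Pi.sub_apply]
    congr 1
    exact Finset.sum_congr rfl fun i _ => by ring
  have hint : Integrable (fun y : Fin n → ℝ => Real.exp (σ⁻¹ * ((y - D.mean b) ⬝ᵥ x)))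
      (D.dataLaw σ b) := by
    rw [heq, dataLaw]
    exact Integrable.fintype_prod
      (f := fun i (z : ℝ) => Real.exp (-(σ⁻¹ * x i * D.mean b i)) * Real.exp ((σ⁻¹ * x i) * z))
      fun i => (integrable_exp_mul_gaussianReal _).const_mul _
  rw [← ofReal_integral_eq_lintegral_ofReal hint (ae_of_all _ fun y => (Real.exp_pos _).le)]
  congr 1
  rw [heq, dataLaw, integral_fintype_prod_eq_prod
    (fun i (z : ℝ) => Real.exp (-(σ⁻¹ * x i * D.mean b i)) * Real.exp ((σ⁻¹ * x i) * z))]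
  have hi : ∀ i, ∫ z, Real.exp (-(σ⁻¹ * x i * D.mean b i)) * Real.exp ((σ⁻¹ * x i) * z)
      ∂gaussianReal (D.mean b i) (Real.toNNReal (σ ^ 2)) = Real.exp (x i * x i / 2) := by
    intro i
    have h := mgf_gaussianReal (p := gaussianReal (D.mean b i) (Real.toNNReal (σ ^ 2)))
      (X := id) (Measure.map_id) (σ⁻¹ * x i)
    simp only [mgf, id] at h
    rw [integral_const_mul, h, ← Real.exp_add, Real.coe_toNNReal _ (sq_nonneg σ)]
    congr 1
    field_simp
    ring
  simp only [hi, ← Real.exp_sum, dotProduct, Finset.sum_div]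

/-- The moment generating function of the test statistic of pure noise, which has a `χ²`
distribution. -/
lemma lintegral_exp_W_noise (hn : n ≠ 0) {σ : ℝ} (hσ : 0 < σ) {g : Fin D.G}
    (hrank : (D.X g).rank = D.size g) (b : D.Coef) {c : ℝ} (hc : 1 < c) :
    ∫⁻ y, ENNReal.ofReal (Real.exp (D.W σ (y - D.mean b) g / (2 * c))) ∂D.dataLaw σ b =
      ENNReal.ofReal (√(c / (c - 1)) ^ D.size g) := by
  have hA := gram_posDef hrank
  have hK := gaussMass_pos hA
  have hc0 : 0 < c := by linarith
  have hc1 : 0 < c - 1 := by linarith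
  -- `exp (W/(2c))` is written as a Gaussian average over `u` of exponentials linear in `y`, which
  -- avoids the density of the `χ²` distribution; Tonelli then applies.
  have hlin : ∀ y : Fin n → ℝ, ENNReal.ofReal (Real.exp (D.W σ (y - D.mean b) g / (2 * c))) =
      ENNReal.ofReal (√c ^ D.size g * (gaussMass (D.gram g))⁻¹) *
        ∫⁻ u : Fin (D.size g) → ℝ,
          ENNReal.ofReal (Real.exp (σ⁻¹ * ((y - D.mean b) ⬝ᵥ (D.X g *ᵥ u)))) *
          ENNReal.ofReal (Real.exp (-(c * quad (D.gram g) u / 2))) := by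
    intro y
    have h := integral_exp_linear_sub_quad hA σ⁻¹ hc0 (D.lse (y - D.mean b) g)
    have hint := integrable_exp_linear_sub_quad hA σ⁻¹ hc0 (D.lse (y - D.mean b) g)
    simp only [← ENNReal.ofReal_mul (Real.exp_pos _).le, ← Real.exp_add, ← sub_eq_add_neg,
      dotProduct_X_mulVec hrank]
    rw [← ofReal_integral_eq_lintegral_ofReal hint (ae_of_all _ fun y => (Real.exp_pos _).le), h,
      ← ENNReal.ofReal_mul (by positivity), W_eq hn]
    congr 1
    have : quad (D.gram g) (D.lse (y - D.mean b) g) / σ ^ 2 / (2 * c) =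
      σ⁻¹ ^ 2 * quad (D.gram g) (D.lse (y - D.mean b) g) / (2 * c) := by
      field_simp
    rw [this]
    have := Real.sqrt_pos.2 hc0
    field_simp
  simp only [hlin]
  have hq := continuous_quad (D.gram g)
  have hmeas : Measurable (Function.uncurry fun (y : Fin n → ℝ) (u : Fin (D.size g) → ℝ) =>
      ENNReal.ofReal (Real.exp (σ⁻¹ * ((y - D.mean b) ⬝ᵥ (D.X g *ᵥ u)))) *
        ENNReal.ofReal (Real.exp (-(c * quad (D.gram g) u / 2)))) := by
    simp only [Function.uncurry_def]
    refine (Measurable.ennreal_ofReal ?_).mul (Measurable.ennreal_ofReal ?_)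
    · exact Continuous.measurable (by fun_prop)
    · exact Continuous.measurable (by fun_prop)
  rw [lintegral_const_mul _ hmeas.lintegral_prod_right, lintegral_lintegral_swap hmeas.aemeasurable]
  -- Averaging over `y` costs `exp (quad u / 2)` and lowers the precision from `c` to `c - 1`,
  -- whence `c > 1`.
  have hinner : ∀ u : Fin (D.size g) → ℝ,
      ∫⁻ y, ENNReal.ofReal (Real.exp (σ⁻¹ * ((y - D.mean b) ⬝ᵥ (D.X g *ᵥ u)))) *
        ENNReal.ofReal (Real.exp (-(c * quad (D.gram g) u / 2))) ∂D.dataLaw σ b =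
      ENNReal.ofReal (Real.exp (-((c - 1) * quad (D.gram g) u) / 2)) := by
    intro u
    have hm : Measurable fun y : Fin n → ℝ => Real.exp (σ⁻¹ * ((y - D.mean b) ⬝ᵥ (D.X g *ᵥ u))) :=
      Continuous.measurable (by fun_prop)
    rw [lintegral_mul_const _ hm.ennreal_ofReal, lintegral_exp_dotProduct_dataLaw D hσ b,
      ← ENNReal.ofReal_mul (Real.exp_pos _).le, ← Real.exp_add, ← dotProduct_gram_mulVec, ← quad]
    congr 2
    ring
  simp only [hinner]
  rw [← ofReal_integral_eq_lintegral_ofReal (integrable_exp_neg_quad hA hc1)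
    (ae_of_all _ fun y => (Real.exp_pos _).le), integral_exp_neg_quad _ hc1,
    ← ENNReal.ofReal_mul (by positivity), Real.sqrt_div hc0.le, div_pow]
  congr 1
  field_simp

/-- The event that the exponential moments of the noise statistics add up to at most `B`. -/
def noiseEvent (D : GroupDesign n) (σ : ℝ) (b : D.Coef) (c B : ℝ) : Set (Fin n → ℝ) :=
  {y | ∑ g, Real.exp (D.W σ (y - D.mean b) g / (2 * c)) ≤ B}

/-- Markov's inequality for the sum; linearity of expectation makes independence between groups
unnecessary. -/
lemma dataLaw_noiseEvent_ge (hn : n ≠ 0) {σ : ℝ} (hσ : 0 < σ)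
    (hrank : ∀ g, (D.X g).rank = D.size g) (b : D.Coef) {c B : ℝ} (hc : 1 < c) (hB : 0 < B)
    {s : ℕ} (hs : ∀ g, D.size g ≤ s) :
    1 - ENNReal.ofReal (√(c / (c - 1)) ^ s * D.G / B) ≤
      D.dataLaw σ b (D.noiseEvent σ b c B) := by
  have hc1 : 0 < c - 1 := by linarith
  have hW : ∀ g, Measurable fun y => Real.exp (D.W σ (y - D.mean b) g / (2 * c)) := by
    intro g
    have := (measurable_W (D := D) σ g).comp (measurable_id.sub_const (D.mean b))
    exact (this.div_const _).exp
  have hsum : Measurable fun y => ∑ g, Real.exp (D.W σ (y - D.mean b) g / (2 * c)) :=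
    Finset.measurable_sum _ fun g _ => hW g
  have hmeas : MeasurableSet (D.noiseEvent σ b c B) := measurableSet_le hsum measurable_const
  rw [← compl_compl (D.noiseEvent σ b c B), prob_compl_eq_one_sub hmeas.compl]
  refine tsub_le_tsub_left ?_ _
  have hsub : (D.noiseEvent σ b c B)ᶜ ⊆ {y | ENNReal.ofReal B ≤
      ENNReal.ofReal (∑ g, Real.exp (D.W σ (y - D.mean b) g / (2 * c)))} := by
    intro y hy
    simp only [noiseEvent, Set.mem_compl_iff, Set.mem_ofPred_eq, not_le] at hy
    exact ENNReal.ofReal_le_ofReal hy.le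
  refine (measure_mono hsub).trans ((meas_ge_le_lintegral_div
    (ENNReal.measurable_ofReal.comp hsum).aemeasurable (by simpa using hB)
    ENNReal.ofReal_ne_top).trans ?_)
  rw [ENNReal.ofReal_div_of_pos hB]
  gcongr
  calc ∫⁻ y, ENNReal.ofReal (∑ g, Real.exp (D.W σ (y - D.mean b) g / (2 * c))) ∂D.dataLaw σ b
      = ∑ g, ENNReal.ofReal (√(c / (c - 1)) ^ D.size g) := by
        simp only [ENNReal.ofReal_sum_of_nonneg fun g _ => (Real.exp_pos _).le]
        rw [lintegral_finsetSum _ fun g _ => (hW g).ennreal_ofReal]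
        exact Finset.sum_congr rfl fun g _ => lintegral_exp_W_noise hn hσ (hrank g) b hc
    _ ≤ ∑ _g : Fin D.G, ENNReal.ofReal (√(c / (c - 1)) ^ s) := by
        refine Finset.sum_le_sum fun g _ => ENNReal.ofReal_le_ofReal ?_
        refine pow_le_pow_right₀ (Real.one_le_sqrt.2 ?_) (hs g)
        rw [le_div_iff₀ hc1]; linarith
    _ = ENNReal.ofReal (√(c / (c - 1)) ^ s * D.G) := by
        rw [Finset.sum_const, Finset.card_univ, Fintype.card_fin, nsmul_eq_mul, mul_comm,
          ENNReal.ofReal_mul (by positivity), ENNReal.ofReal_natCast]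

end GroupDesign

/-! ### Test statistics and the estimate of `τ` on the noise event -/

namespace GroupDesign

variable {n : ℕ} {D : GroupDesign n}

lemma W_of_notMem_active (horth : D.BlockOrthogonal) {g : Fin D.G}
    (hrank : (D.X g).rank = D.size g) {b : D.Coef} (hg : g ∉ D.active b) (σ : ℝ)
    (y : Fin n → ℝ) : D.W σ y g = D.W σ (y - D.mean b) g := by
  have hb : b g = 0 := by simpa [active] using hg
  rw [W, W, lse_eq_add horth hrank b y, hb, zero_add]

lemma half_signal_sub_noise_le_W (hn : n ≠ 0) (horth : D.BlockOrthogonal) {g : Fin D.G}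
    (hrank : (D.X g).rank = D.size g) (b : D.Coef) {σ : ℝ} (y : Fin n → ℝ) :
    quad (D.gram g) (b g) / σ ^ 2 / 2 - D.W σ (y - D.mean b) g ≤ D.W σ y g := by
  have hA := gram_posDef hrank
  rw [W_eq hn, W_eq hn, lse_eq_add horth hrank b y, div_right_comm, ← sub_div]
  refine div_le_div_of_nonneg_right ?_ (sq_nonneg σ)
  set e := D.lse (y - D.mean b) g
  -- Nonnegativity of the form at `b + 2e` is exactly `q (b + e) ≥ q b / 2 - q e`.
  have h1 := quad_nonneg hA.posSemidef (b g + (2 : ℝ) • e)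
  rw [quad_add hA.isHermitian, quad_smul, mulVec_smul, dotProduct_smul, smul_eq_mul] at h1
  rw [quad_add hA.isHermitian]
  linarith

lemma signal_ge (hn : n ≠ 0) {g : Fin D.G} (hrank : (D.X g).rank = D.size g)
    (hsize : 0 < D.size g) {C₁ : ℝ} (hC₁ : 0 < C₁) (hspec : ∀ e ∈ spectrum ℝ (D.Q g), C₁ < e)
    {b : Fin (D.size g) → ℝ} {β : ℝ} (hβ : 0 ≤ β) (hb : ∀ j, β < |b j|) :
    n * C₁ * β ^ 2 ≤ quad (D.gram g) b := by
  have hn' : (0 : ℝ) < n := by exact_mod_cast Nat.pos_of_ne_zero hn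
  have hQ : D.Q g = (n : ℝ)⁻¹ • D.gram g := rfl
  have hherm : (D.Q g).IsHermitian := by
    have h := (gram_posDef hrank).isHermitian
    rw [hQ, IsHermitian, conjTranspose_smul, h.eq, star_trivial]
  have h := mul_dotProduct_self_le_quad hherm (fun e he => (hspec e he).le) b
  have hquad : quad (D.Q g) b = (n : ℝ)⁻¹ * quad (D.gram g) b := by
    rw [quad, quad, hQ, smul_mulVec, dotProduct_smul, smul_eq_mul]
  rw [hquad, ← div_eq_inv_mul, le_div_iff₀ hn'] at h
  refine le_trans ?_ h
  have hj : β ^ 2 ≤ b ⬝ᵥ b := by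
    have h1 := Finset.single_le_sum (f := fun i => b i * b i) (s := Finset.univ)
      (fun i _ => mul_self_nonneg _) (Finset.mem_univ (⟨0, hsize⟩ : Fin (D.size g)))
    refine le_trans ?_ h1
    have h2 := hb ⟨0, hsize⟩
    rw [← abs_mul_abs_self (b _)]
    nlinarith
  calc n * C₁ * β ^ 2 ≤ n * C₁ * (b ⬝ᵥ b) := by gcongr
    _ = _ := by ring

lemma W_noise_le {σ c η : ℝ} {b : D.Coef} {y : Fin n → ℝ} (hc : 0 < c) (hG : 0 < D.G)
    (hy : y ∈ D.noiseEvent σ b c ((D.G : ℝ) ^ (1 + η))) (g : Fin D.G) :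
    D.W σ (y - D.mean b) g ≤ 2 * c * (1 + η) * Real.log D.G := by
  have hG' : (0 : ℝ) < D.G := by exact_mod_cast hG
  have h1 : Real.exp (D.W σ (y - D.mean b) g / (2 * c)) ≤ (D.G : ℝ) ^ (1 + η) :=
    (Finset.single_le_sum (f := fun g => Real.exp (D.W σ (y - D.mean b) g / (2 * c)))
      (fun _ _ => (Real.exp_pos _).le) (Finset.mem_univ g)).trans hy
  rw [Real.rpow_def_of_pos hG', Real.exp_le_exp, div_le_iff₀ (by positivity)] at h1
  linarith

/-- Since `c₁ ≥ 2`, each exceedance contributes at least `G^(1/c)` to a sum bounded by `G^(1+η)`. -/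
lemma ncard_noise_exceedances_le {σ c η c₁ : ℝ} {b : D.Coef} {y : Fin n → ℝ} (hc : 0 < c)
    (hc₁ : 2 ≤ c₁) (hG : 0 < D.G)
    (hy : y ∈ D.noiseEvent σ b c ((D.G : ℝ) ^ (1 + η))) :
    (({g | c₁ * Real.log D.G < D.W σ (y - D.mean b) g} : Set (Fin D.G)).ncard : ℝ) ≤
      (D.G : ℝ) ^ (1 + η - 1 / c) := by
  classical
  have hG' : (0 : ℝ) < D.G := by exact_mod_cast hG
  have hlog : 0 ≤ Real.log D.G := Real.log_nonneg (by exact_mod_cast hG)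
  rw [Set.ncard_eq_toFinset_card', Real.rpow_sub hG', le_div_iff₀ (by positivity)]
  set S := ({g | c₁ * Real.log D.G < D.W σ (y - D.mean b) g} : Set (Fin D.G)).toFinset with hS
  calc (S.card : ℝ) * (D.G : ℝ) ^ (1 / c) = ∑ _g ∈ S, (D.G : ℝ) ^ (1 / c) := by
        rw [Finset.sum_const, nsmul_eq_mul]
    _ ≤ ∑ g ∈ S, Real.exp (D.W σ (y - D.mean b) g / (2 * c)) := by
        refine Finset.sum_le_sum fun g hg => ?_
        have h : c₁ * Real.log D.G < D.W σ (y - D.mean b) g := by simpa [hS] using hg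
        rw [Real.rpow_def_of_pos hG', Real.exp_le_exp, le_div_iff₀ (by positivity)]
        have : Real.log D.G * (1 / c) * (2 * c) = 2 * Real.log D.G := by field_simp
        rw [this]
        nlinarith
    _ ≤ ∑ g, Real.exp (D.W σ (y - D.mean b) g / (2 * c)) :=
        Finset.sum_le_sum_of_subset_of_nonneg (Finset.subset_univ _)
          fun _ _ _ => (Real.exp_pos _).le
    _ ≤ _ := hy

lemma ncard_le_G (S : Set (Fin D.G)) : S.ncard ≤ D.G := by
  have := Set.ncard_le_ncard (Set.subset_univ S)
  rwa [Set.ncard_univ, Nat.card_fin] at this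

lemma inv_G_le_tauEB (σ c₁ c₂ : ℝ) (y : Fin n → ℝ) : 1 / (D.G : ℝ) ≤ D.tauEB σ c₁ c₂ y :=
  le_max_left _ _

lemma tauEB_le_one (hG : 0 < D.G) {c₂ : ℝ} (hc₂ : 1 ≤ c₂) (σ c₁ : ℝ) (y : Fin n → ℝ) :
    D.tauEB σ c₁ c₂ y ≤ 1 := by
  have hG' : (1 : ℝ) ≤ D.G := by exact_mod_cast hG
  refine max_le ((div_le_one (by linarith)).2 hG') ?_
  rw [one_div_mul_eq_div, div_le_one (by positivity)]
  have : (({g | c₁ * Real.log D.G < D.W σ y g} : Set (Fin D.G)).ncard : ℝ) ≤ D.G := by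
    exact_mod_cast ncard_le_G _
  nlinarith

/-- An exceedance comes from an active group or from pure noise, and both kinds number at most a
multiple of `G^ε`. -/
lemma tauEB_le (horth : D.BlockOrthogonal) (hrank : ∀ g, (D.X g).rank = D.size g)
    {σ c η c₁ c₂ ε K : ℝ} {b : D.Coef} {y : Fin n → ℝ} (hc : 0 < c) (hc₁ : 2 ≤ c₁)
    (hc₂ : 1 ≤ c₂) (hG : 0 < D.G) (hε : 0 ≤ ε) (hηε : 1 + η - 1 / c ≤ ε) (hK : 0 ≤ K)
    (hactive : ((D.active b).ncard : ℝ) ≤ K * (D.G : ℝ) ^ ε)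
    (hy : y ∈ D.noiseEvent σ b c ((D.G : ℝ) ^ (1 + η))) :
    D.tauEB σ c₁ c₂ y ≤ (K + 1) * (D.G : ℝ) ^ (ε - 1) := by
  have hG1 : (1 : ℝ) ≤ D.G := by exact_mod_cast hG
  have hG' : (0 : ℝ) < D.G := by linarith
  have hpow : 1 ≤ (D.G : ℝ) ^ ε := Real.one_le_rpow hG1 hε
  have hsub : {g | c₁ * Real.log D.G < D.W σ y g} ⊆
      D.active b ∪ {g | c₁ * Real.log D.G < D.W σ (y - D.mean b) g} := by
    intro g hg
    by_cases h : g ∈ D.active b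
    · exact Or.inl h
    · refine Or.inr ?_
      rw [Set.mem_ofPred_eq, ← W_of_notMem_active horth (hrank g) h]
      exact hg
  have hcard : (({g | c₁ * Real.log D.G < D.W σ y g} : Set (Fin D.G)).ncard : ℝ) ≤
      (K + 1) * (D.G : ℝ) ^ ε := by
    have h1 := (Set.ncard_le_ncard hsub).trans (Set.ncard_union_le _ _)
    have h2 := ncard_noise_exceedances_le hc hc₁ hG hy
    have h3 : (D.G : ℝ) ^ (1 + η - 1 / c) ≤ (D.G : ℝ) ^ ε :=
      Real.rpow_le_rpow_of_exponent_le hG1 hηε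
    have h4 : (({g | c₁ * Real.log D.G < D.W σ y g} : Set (Fin D.G)).ncard : ℝ) ≤
        (D.active b).ncard +
          ({g | c₁ * Real.log D.G < D.W σ (y - D.mean b) g} : Set (Fin D.G)).ncard := by
      exact_mod_cast h1
    linarith
  rw [Real.rpow_sub_one hG'.ne', tauEB, ← mul_div_assoc]
  refine max_le ?_ ?_
  · gcongr
    nlinarith
  · rw [one_div_mul_eq_div]
    refine div_le_div₀ (by positivity) hcard hG' ?_
    nlinarith

/-- If the posterior weights separate the active groups from the inactive ones, the rule and the
estimator select the active groups. -/
lemma selected_eq_active {a : ℝ} {L : ℝ → ℝ} (hLpos : ∀ t, 0 < t → 0 < L t)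
    (hprior : IntegrableOn (fun t : ℝ => t ^ (-a - 1) * L t) (Set.Ioi 0))
    (hn : n ≠ 0) {σ c₁ c₂ : ℝ} (hσ : 0 < σ) (horth : D.BlockOrthogonal)
    (hrank : ∀ g, (D.X g).rank = D.size g) (hG : 0 < D.G) {b : D.Coef} {y : Fin n → ℝ}
    (hinactive : ∀ g ∉ D.active b, D.postWeight a L σ (D.tauEB σ c₁ c₂ y) y g ≤ 1 / 2)
    (hactive : ∀ g ∈ D.active b, 1 / 2 < D.postWeight a L σ (D.tauEB σ c₁ c₂ y) y g)
    (hW : ∀ g ∈ D.active b, 0 < D.W σ y g) :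
    D.htSelectedEB a L σ c₁ c₂ y = D.active b ∧ D.htRuleEB a L σ c₁ c₂ y = D.active b := by
  have hG' : (0 : ℝ) < D.G := by exact_mod_cast hG
  have hτ : 0 < D.tauEB σ c₁ c₂ y :=
    lt_of_lt_of_le (by positivity) (inv_G_le_tauEB σ c₁ c₂ y)
  have hrule : D.htRuleEB a L σ c₁ c₂ y = D.active b := by
    ext g
    refine ⟨fun h => ?_, fun h => hactive g h⟩
    by_contra hg
    exact absurd h (not_lt.2 (hinactive g hg))
  refine ⟨?_, hrule⟩
  ext g
  rw [htSelectedEB, Set.mem_ofPred_eq, htEstimatorEB]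
  by_cases hg : g ∈ D.active b
  · refine iff_of_true ?_ hg
    have hw := hactive g hg
    rw [if_pos hw, postMean_eq hLpos hprior hn hσ hτ horth hrank]
    -- A vanishing least squares estimate would force `W = 0`.
    refine smul_ne_zero (by linarith) fun h => ?_
    have := hW g hg
    simp [W, h] at this
  · refine iff_of_false ?_ hg
    rw [if_neg (not_lt.2 (hinactive g hg))]
    simp

end GroupDesign

/-! ### Limits, choice of exponents and conclusion -/

section Asymptotics

lemma eventually_const_mul_log_le_rpow (K : ℝ) {k p : ℝ} (hk : 0 < k) (hp : 0 < p) :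
    ∀ᶠ n : ℕ in atTop, K * Real.log n ≤ k * (n : ℝ) ^ p := by
  have h1 := ((isLittleO_log_rpow_atTop hp).comp_tendsto tendsto_natCast_atTop_atTop).def
    (c := k / (|K| + 1)) (by positivity)
  filter_upwards [h1, eventually_ge_atTop 1] with n hn hn1
  have hn1' : (1 : ℝ) ≤ n := by exact_mod_cast hn1
  have hlog := Real.log_nonneg hn1'
  simp only [Function.comp, Real.norm_eq_abs, abs_of_nonneg hlog] at hn
  rw [abs_of_nonneg (by positivity : 0 ≤ (n : ℝ) ^ p), div_mul_eq_mul_div,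
    le_div_iff₀ (by positivity)] at hn
  nlinarith [le_abs_self K]

/-- The noise event fails with probability `O(G^(-η))`. Only monotonicity of the measure is applied
to `S`, so its measurability is not needed. -/
lemma tendsto_measure_one_of_noiseEvent (D : (n : ℕ) → GroupDesign n)
    (β₀ : (n : ℕ) → (D n).Coef) {σ : ℝ} (hσ : 0 < σ)
    (hrank : ∀ n g, ((D n).X g).rank = (D n).size g) {s : ℕ} (hs : ∀ n g, (D n).size g ≤ s)
    (hG : Tendsto (fun n => (D n).G) atTop atTop) {c η : ℝ} (hc : 1 < c) (hη : 0 < η)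
    (S : (n : ℕ) → Set (Fin n → ℝ))
    (hS : ∀ᶠ n in atTop, (D n).noiseEvent σ (β₀ n) c (((D n).G : ℝ) ^ (1 + η)) ⊆ S n) :
    Tendsto (fun n => (D n).dataLaw σ (β₀ n) (S n)) atTop (𝓝 1) := by
  have hGR : Tendsto (fun n => ((D n).G : ℝ)) atTop atTop := tendsto_natCast_atTop_atTop.comp hG
  have hlim : Tendsto (fun n => 1 - ENNReal.ofReal
      (√(c / (c - 1)) ^ s * ((D n).G : ℝ) ^ (-η))) atTop (𝓝 1) := by
    have h1 := ((tendsto_rpow_neg_atTop hη).comp hGR).const_mul (√(c / (c - 1)) ^ s)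
    have h2 := ENNReal.Tendsto.sub (tendsto_const_nhds (x := (1 : ENNReal)))
      (ENNReal.tendsto_ofReal h1) (Or.inl ENNReal.one_ne_top)
    simpa using h2
  refine tendsto_of_tendsto_of_tendsto_of_le_of_le' hlim tendsto_const_nhds ?_
    (Eventually.of_forall fun n => prob_le_one)
  filter_upwards [hS, hG.eventually_ge_atTop 1, eventually_ge_atTop 1] with n hn hGn hn1
  have hG' : (0 : ℝ) < (D n).G := by exact_mod_cast hGn
  refine le_trans ?_ (measure_mono hn)
  have h := GroupDesign.dataLaw_noiseEvent_ge (D := D n) (by omega) hσ (hrank n) (β₀ n) hc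
    (B := ((D n).G : ℝ) ^ (1 + η)) (by positivity) (hs n)
  refine le_trans (le_of_eq ?_) h
  congr 2
  rw [Real.rpow_neg hG'.le, Real.rpow_add hG', Real.rpow_one]
  field_simp

end Asymptotics

/-- Both alternatives amount to `1 / (2 (1 - ε)) < min a 1`, which leaves room for `α` with `2α(1 -
ε) > 1`; the last inequality then holds for all small `η`. The condition `2η ≤ ε` keeps noise
exceedances below the order `G^ε`. -/
lemma exists_exponents {a ε : ℝ} (hε : 0 < ε)
    (haε : (1 ≤ a ∧ ε < 1 / 2) ∨ (1 / 2 < a ∧ a < 1 ∧ ε < 1 - 1 / (2 * a))) :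
    0 < a ∧ ∃ α η : ℝ, 0 < α ∧ α ≤ 1 ∧ α < a ∧ 0 < η ∧ η < 1 ∧ 2 * η ≤ ε ∧
      (1 - η)⁻¹ * (1 + η) < 2 * α * (1 - ε) := by
  have h0 : 0 < a := by rcases haε with h | h <;> linarith [h.1]
  have h1 : ε < 1 := by
    rcases haε with h | h
    · linarith [h.2]
    · have : 0 < 1 / (2 * a) := by positivity
      linarith [h.2.2]
  have h1' : 0 < 1 - ε := by linarith
  have h2 : 1 / (2 * (1 - ε)) < min a 1 := by
    rw [div_lt_iff₀ (by positivity)]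
    rcases haε with ⟨h, h'⟩ | ⟨h, h', h''⟩
    · rw [min_eq_right h]; linarith
    · rw [min_eq_left h'.le]
      have h3 : 1 / (2 * a) < 1 - ε := by linarith
      rw [div_lt_iff₀ (by positivity)] at h3
      linarith
  obtain ⟨α, hα, hα'⟩ := exists_between h2
  have hα0 : 0 < α := lt_trans (by positivity) hα
  set R := 2 * α * (1 - ε) with hR
  have hR1 : 1 < R := by
    rw [div_lt_iff₀ (by positivity)] at hα
    linarith
  -- `1 + η < R (1 - η)` means `η < (R - 1)/(R + 1)`; halving makes it strict.
  have hq : 0 < (R - 1) / (2 * (R + 1)) := div_pos (by linarith) (by linarith)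
  refine ⟨h0, α, min (ε / 2) ((R - 1) / (2 * (R + 1))), hα0, (hα'.trans_le (min_le_right _ _)).le,
    hα'.trans_le (min_le_left _ _), lt_min (by linarith) hq, ?_, ?_, ?_⟩
  · linarith [min_le_left (ε / 2) ((R - 1) / (2 * (R + 1)))]
  · linarith [min_le_left (ε / 2) ((R - 1) / (2 * (R + 1)))]
  · set η := min (ε / 2) ((R - 1) / (2 * (R + 1)))
    have hη1 : η ≤ ε / 2 := min_le_left _ _
    have hη2 : η ≤ (R - 1) / (2 * (R + 1)) := min_le_right _ _
    rw [le_div_iff₀ (by linarith)] at hη2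
    rw [inv_mul_lt_iff₀ (by linarith)]
    linarith

/-- The test statistics of the active groups eventually exceed every multiple of `log n` on the
noise event. -/
lemma eventually_log_le_W_active (D : (n : ℕ) → GroupDesign n) (β₀ : (n : ℕ) → (D n).Coef)
    {σ : ℝ} (hσ : 0 < σ) (hG : ∀ n, (D n).G ≤ n) (hsize : ∀ n g, 0 < (D n).size g)
    (hrank : ∀ n g, ((D n).X g).rank = (D n).size g) (horth : ∀ n, (D n).BlockOrthogonal)
    (hA1 : ∃ C₁ : ℝ, 0 < C₁ ∧
      ∀ n, ∀ g ∈ (D n).active (β₀ n), ∀ e ∈ spectrum ℝ ((D n).Q g), C₁ < e)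
    (hA2 : ∃ c b : ℝ, 0 < c ∧ 0 ≤ b ∧ b < 1 / 2 ∧
      ∀ n, ∀ g ∈ (D n).active (β₀ n), ∀ j, c * (n : ℝ) ^ (-b) < |β₀ n g j|)
    {c η : ℝ} (hc : 0 < c) (hη : 0 < η) (K : ℝ) :
    ∀ᶠ n in atTop, ∀ y ∈ (D n).noiseEvent σ (β₀ n) c (((D n).G : ℝ) ^ (1 + η)),
      ∀ g ∈ (D n).active (β₀ n), K * Real.log n ≤ (D n).W σ y g := by
  obtain ⟨C₁, hC₁, hA1⟩ := hA1
  obtain ⟨d, b, hd, _, hb, hA2⟩ := hA2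
  -- The extra `2c(1+η)` pays for the noise subtracted from half the signal.
  filter_upwards [eventually_const_mul_log_le_rpow (K + 2 * c * (1 + η))
      (k := C₁ * d ^ 2 / σ ^ 2 / 2) (p := 1 - 2 * b) (by positivity) (by linarith),
    eventually_ge_atTop 1] with n hn hn1 y hy g hg
  have hn0 : (0 : ℝ) < n := by exact_mod_cast hn1
  have hGpos : 0 < (D n).G := g.pos
  have hG' : (0 : ℝ) < (D n).G := by exact_mod_cast hGpos
  have hlog : Real.log (D n).G ≤ Real.log n :=
    Real.log_le_log hG' (by exact_mod_cast hG n)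
  have h1 := GroupDesign.half_signal_sub_noise_le_W (σ := σ) (by omega) (horth n) (hrank n g)
    (β₀ n) y
  have h2 := GroupDesign.signal_ge (by omega) (hrank n g) (hsize n g) hC₁ (hA1 n g hg)
    (by positivity) (hA2 n g hg)
  have h3 := GroupDesign.W_noise_le hc hGpos hy g
  have h4 : (n : ℝ) * C₁ * (d * (n : ℝ) ^ (-b)) ^ 2 = C₁ * d ^ 2 * (n : ℝ) ^ (1 - 2 * b) := by
    rw [mul_pow, ← Real.rpow_mul_natCast hn0.le, show 1 - 2 * b = 1 + -b * (2 : ℕ) by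
      push_cast; ring, Real.rpow_add hn0, Real.rpow_one]
    ring
  have h5 : C₁ * d ^ 2 / σ ^ 2 / 2 * (n : ℝ) ^ (1 - 2 * b) ≤
      quad ((D n).gram g) (β₀ n g) / σ ^ 2 / 2 := by
    rw [h4] at h2
    calc _ = C₁ * d ^ 2 * (n : ℝ) ^ (1 - 2 * b) / σ ^ 2 / 2 := by ring
      _ ≤ _ := by gcongr
  have h6 : 2 * c * (1 + η) * Real.log (D n).G ≤ 2 * c * (1 + η) * Real.log n := by gcongr
  linarith

/-- `τ^(-2a) ≤ n^(2a)`, while the assumption on `w` makes the exponential at most `n^(-2a-1)`. -/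
lemma inv_rpow_mul_exp_le {a τ w : ℝ} {n : ℕ} (ha : 0 < a) (hn : 1 ≤ n) (hτ : 1 / (n : ℝ) ≤ τ)
    (hw : 32 / 3 * (2 * a + 1) * Real.log n ≤ w) :
    ((τ ^ 2) ^ a)⁻¹ * Real.exp (-(3 * w / 32)) ≤ 1 / n := by
  have hn0 : (0 : ℝ) < n := by exact_mod_cast hn
  have hτ0 : 0 < τ := lt_of_lt_of_le (by positivity) hτ
  have hlog : -Real.log n ≤ Real.log τ := by
    rw [← Real.log_inv, ← one_div]
    exact Real.log_le_log (by positivity) hτ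
  rw [Real.rpow_def_of_pos (by positivity), ← Real.exp_neg, ← Real.exp_add, Real.log_pow,
    one_div, ← Real.exp_log hn0, ← Real.exp_neg, Real.exp_le_exp]
  push_cast
  nlinarith [mul_le_mul_of_nonneg_left hlog ha.le]

theorem theorem3
    -- for each sample size: the design and the true coefficients
    (D : (n : ℕ) → GroupDesign n) (β₀ : (n : ℕ) → (D n).Coef)
    -- known error standard deviation, constants of the empirical Bayes estimate
    (σ c₁ c₂ : ℝ) (hσ : 0 < σ) (hc₁ : 2 ≤ c₁) (hc₂ : 1 ≤ c₂)
    -- the prior on the squared local shrinkage parameters, which is proper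
    (a : ℝ) (L : ℝ → ℝ) (hLpos : ∀ t, 0 < t → 0 < L t)
    (hLmeas : Measurable fun t : Set.Ioi (0 : ℝ) => L t)
    (hLnonconst : ¬ ∃ c : ℝ, ∀ t, 0 < t → L t = c)
    (hLslow : IsSlowlyVarying L)
    (hprior : IntegrableOn (fun t : ℝ => t ^ (-a - 1) * L t) (Set.Ioi 0))
    -- `L` is bounded away from zero near infinity, and bounded
    (hLlower : ∃ c₀ : ℝ, 0 < c₀ ∧ ∃ t₀ : ℝ, 0 < t₀ ∧ ∀ t, t₀ ≤ t → c₀ ≤ L t)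
    (hLupper : ∃ M : ℝ, 0 < M ∧ ∀ t, 0 < t → L t ≤ M)
    -- the number of groups, nonempty groups, full column rank, block orthogonal design
    (hG : ∀ n, (D n).G ≤ n) (hsize : ∀ n g, 0 < (D n).size g)
    (hrank : ∀ n g, ((D n).X g).rank = (D n).size g)
    (horth : ∀ n, (D n).BlockOrthogonal)
    -- (A1): the eigenvalues of `Q_{n,g}` are bounded away from zero for the active groups
    (hA1 : ∃ C₁ : ℝ, 0 < C₁ ∧ ∀ n, ∀ g ∈ (D n).active (β₀ n), ∀ e ∈ spectrum ℝ ((D n).Q g), C₁ < e)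
    -- (A2): the coefficients of the active groups exceed `c * n ^ (-b)` in absolute value
    (hA2 : ∃ c b : ℝ, 0 < c ∧ 0 ≤ b ∧ b < 1 / 2 ∧
      ∀ n, ∀ g ∈ (D n).active (β₀ n), ∀ j, c * (n : ℝ) ^ (-b) < |β₀ n g j|)
    -- (A3): the group sizes are bounded
    (hA3 : ∃ s : ℕ, ∀ n g, (D n).size g ≤ s)
    -- the number of active groups
    (hGA : Tendsto (fun n => ((D n).active (β₀ n)).ncard) atTop atTop)
    (ε₁ ε₂ : ℝ) (hε₁ : 0 < ε₁) (hε₁₂ : ε₁ < ε₂)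
    (hGA_lower : (fun n => ((D n).G : ℝ) ^ ε₁) =O[atTop]
      fun n => (((D n).active (β₀ n)).ncard : ℝ))
    (hGA_upper : (fun n => (((D n).active (β₀ n)).ncard : ℝ)) =O[atTop]
      fun n => ((D n).G : ℝ) ^ ε₂)
    (haε : (1 ≤ a ∧ ε₂ < 1 / 2) ∨ (1 / 2 < a ∧ a < 1 ∧ ε₂ < 1 - 1 / (2 * a))) :
    Tendsto (fun n => (D n).dataLaw σ (β₀ n)
        {y | (D n).htSelectedEB a L σ c₁ c₂ y = (D n).active (β₀ n)}) atTop (𝓝 1) ∧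
      Tendsto (fun n => (D n).dataLaw σ (β₀ n)
        {y | (D n).htRuleEB a L σ c₁ c₂ y = (D n).active (β₀ n)}) atTop (𝓝 1) := by
  obtain ⟨s, hs⟩ := hA3
  obtain ⟨M, -, hM⟩ := hLupper
  obtain ⟨ha, α, η, hα, hα1, hαa, hη, hη1, hηε, hexp⟩ := exists_exponents (hε₁.trans hε₁₂) haε
  obtain ⟨C, hC⟩ := exists_weight_upper_bound hLpos hprior hM hα hα1 hαa s
  obtain ⟨C', hC'⟩ := exists_weight_lower_bound ha hLpos hprior hLlower s
  obtain ⟨K, hK, hGK⟩ := hGA_upper.exists_pos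
  -- With this choice `1 + η - 1/c = 2η`.
  set c := (1 - η)⁻¹ with hc
  have hcinv : 1 / c = 1 - η := by rw [hc, one_div, inv_inv]
  have hc1 : 1 < c := (one_lt_inv₀ (by linarith)).2 (by linarith)
  have hc0 : 0 < c := by linarith
  have hGtop : Tendsto (fun n => (D n).G) atTop atTop :=
    tendsto_atTop_mono (fun n => GroupDesign.ncard_le_G _) hGA
  have hGR : Tendsto (fun n => ((D n).G : ℝ)) atTop atTop :=
    tendsto_natCast_atTop_atTop.comp hGtop
  have hsmall : ∀ᶠ n in atTop, |C| * ((K + 1) ^ 2) ^ α *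
      ((D n).G : ℝ) ^ (-(2 * α * (1 - ε₂) - c * (1 + η))) < 1 / 2 := by
    have h := ((tendsto_rpow_neg_atTop (sub_pos.2 hexp)).comp hGR).const_mul
      (|C| * ((K + 1) ^ 2) ^ α)
    rw [mul_zero] at h
    exact h.eventually_lt_const (by norm_num)
  have hkey : ∀ᶠ n in atTop, ∀ y ∈ (D n).noiseEvent σ (β₀ n) c (((D n).G : ℝ) ^ (1 + η)),
      (D n).htSelectedEB a L σ c₁ c₂ y = (D n).active (β₀ n) ∧
        (D n).htRuleEB a L σ c₁ c₂ y = (D n).active (β₀ n) := by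
    filter_upwards [hsmall, hGK.bound, hGtop.eventually_ge_atTop 1, eventually_ge_atTop 2,
      tendsto_natCast_atTop_atTop.eventually_gt_atTop (4 * |C'|),
      eventually_log_le_W_active D β₀ hσ hG hsize hrank horth hA1 hA2 hc0 hη
        (32 / 3 * (2 * a + 1))] with n hsm hact hGn hn2 hnC hWact y hy
    have hn : n ≠ 0 := by omega
    have hn0 : (0 : ℝ) < n := by exact_mod_cast Nat.pos_of_ne_zero hn
    have hG0 : (0 : ℝ) < (D n).G := by exact_mod_cast hGn
    have hτlow := GroupDesign.inv_G_le_tauEB (D := D n) σ c₁ c₂ y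
    have hτ1 := GroupDesign.tauEB_le_one hGn hc₂ σ c₁ y
    set τ := (D n).tauEB σ c₁ c₂ y with hτdef
    have hτ0 : 0 < τ := lt_of_lt_of_le (by positivity) hτlow
    refine GroupDesign.selected_eq_active hLpos hprior hn hσ (horth n) (hrank n) hGn
      (fun g hg => ?_) (fun g hg => ?_) (fun g hg => ?_)
    · rw [← hτdef, GroupDesign.postWeight_eq hLpos hprior hn hσ hτ0 (horth n) (hrank n)]
      have hW0 := GroupDesign.W_nonneg σ y (hrank n g)
      have hτup : τ ≤ (K + 1) * ((D n).G : ℝ) ^ (ε₂ - 1) := by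
        refine GroupDesign.tauEB_le (horth n) (hrank n) hc0 hc₁ hc₂ hGn (by linarith)
          (by rw [hcinv]; linarith) hK.le ?_ hy
        rwa [Real.norm_of_nonneg (by positivity), Real.norm_of_nonneg (by positivity)] at hact
      have hWup := GroupDesign.W_noise_le hc0 hGn hy g
      rw [← GroupDesign.W_of_notMem_active (horth n) (hrank n g) hg] at hWup
      refine (hC _ (hs n g) _ τ hW0 hτ0 hτ1).trans (le_trans ?_ hsm.le)
      -- The bounds on `τ` and on `W` turn the weight bound into a negative power of `G`.
      have h1 : (τ ^ 2) ^ α ≤ ((K + 1) ^ 2) ^ α * ((D n).G : ℝ) ^ (-(2 * α * (1 - ε₂))) := by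
        have h2 : τ ^ 2 ≤ (K + 1) ^ 2 * (((D n).G : ℝ) ^ (ε₂ - 1)) ^ 2 := by
          rw [← mul_pow]; gcongr
        calc (τ ^ 2) ^ α ≤ ((K + 1) ^ 2 * (((D n).G : ℝ) ^ (ε₂ - 1)) ^ 2) ^ α := by gcongr
          _ = _ := by
            rw [Real.mul_rpow (by positivity) (by positivity), ← Real.rpow_mul_natCast hG0.le,
              ← Real.rpow_mul hG0.le]
            congr 2
            push_cast
            ring
      have h3 : Real.exp ((D n).W σ y g / 2) ≤ ((D n).G : ℝ) ^ (c * (1 + η)) := by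
        rw [Real.rpow_def_of_pos hG0, Real.exp_le_exp]
        linarith
      calc C * ((τ ^ 2) ^ α * Real.exp ((D n).W σ y g / 2))
          ≤ |C| * ((τ ^ 2) ^ α * Real.exp ((D n).W σ y g / 2)) := by
            gcongr; exact le_abs_self C
        _ ≤ |C| * (((K + 1) ^ 2) ^ α * ((D n).G : ℝ) ^ (-(2 * α * (1 - ε₂))) *
              ((D n).G : ℝ) ^ (c * (1 + η))) := by gcongr
        _ = _ := by
            rw [mul_assoc (((K + 1) ^ 2) ^ α), ← Real.rpow_add hG0, ← mul_assoc]
            congr 2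
            ring
    · rw [← hτdef, GroupDesign.postWeight_eq hLpos hprior hn hσ hτ0 (horth n) (hrank n)]
      refine lt_of_lt_of_le ?_
        (hC' _ (hs n g) _ τ (GroupDesign.W_nonneg σ y (hrank n g)) hτ0 hτ1)
      have hτn : 1 / (n : ℝ) ≤ τ := by
        refine le_trans ?_ hτlow
        have : ((D n).G : ℝ) ≤ n := by exact_mod_cast hG n
        gcongr
      have h1 := inv_rpow_mul_exp_le ha (by omega) hτn (hWact y hy g hg)
      -- An error below `1/4` keeps the weight above `3/4 - 1/4 = 1/2`.
      have h2 : |C'| * (1 / n) < 1 / 4 := by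
        rw [mul_one_div, div_lt_iff₀ hn0]; linarith
      have h3 : C' * (((τ ^ 2) ^ a)⁻¹ * Real.exp (-(3 * (D n).W σ y g / 32))) ≤
          |C'| * (1 / n) :=
        mul_le_mul (le_abs_self C') h1 (by positivity) (abs_nonneg _)
      linarith
    · refine lt_of_lt_of_le ?_ (hWact y hy g hg)
      have : 0 < Real.log n := Real.log_pos (by exact_mod_cast (by omega : 1 < n))
      positivity
  exact ⟨tendsto_measure_one_of_noiseEvent D β₀ hσ hrank hs hGtop hc1 hη _
      (hkey.mono fun n h y hy => (h y hy).1),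
    tendsto_measure_one_of_noiseEvent D β₀ hσ hrank hs hGtop hc1 hη _
      (hkey.mono fun n h y hy => (h y hy).2)⟩
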